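/- All graphs are finite, simple, undirected, and have at least one vertex; graphs are considered up to isomorphism. For non-adjacent distinct vertices $a,b$ of a graph $G$, an $a,b$-separator is a set $S\subseteq V(G)\setminus\{a,b\}$ such that $a$ and $b$ lie in different connected components of $G-S$; it is a minimal $a,b$-separator if no proper subset of it is an $a,b$-separator. A minimal separator of $G$ is a minimal $a,b$-separator for some pair of non-adjacent distinct vertices $a,b$, and $s(G)$ denotes the number of minimal separators of $G$. A class $\mathcal{G}$ of graphs is tame if there is a real polynomial $p$ such that $s(G)\le p(|V(G)|)$ for all $G\in\mathcal{G}$. For a family $\mathcal{F}$ of graphs, a graph is $\mathcal{F}$-free if no induced subgraph of it is isomorphic to a member of $\mathcal{F}$; we write $\mathcal{F}'\trianglelefteq\mathcal{F}$ if every $\mathcal{F}'$-free graph is $\mathcal{F}$-free. Here $kP_1$ is the graph with $k$ vertices and no edges, $K_n$ and $C_n$ are the complete graph and the cycle on $n$ vertices, the claw is $K_{1,3}$, and the diamond is $K_4$ minus an edge. Theorem. Let $\mathcal{F}$ be a family of graphs, each with at most four vertices, such that $\mathcal{F}\neq\{4P_1,C_4\}$ and $\mathcal{F}\neq\{4P_1,C_4,\text{claw}\}$.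 Then the class of $\mathcal{F}$-free graphs is not tame if and only if $\mathcal{F}'\trianglelefteq\mathcal{F}$ for at least one of the following families $\mathcal{F}'$: (i) $\mathcal{F}'=\{3P_1,\text{diamond}\}$; (ii) $\mathcal{F}'=\{\text{claw},K_4,C_4,\text{diamond}\}$; (iii) $\mathcal{F}'=\{K_3,C_4\}$. -/

import Mathlib

/-- A graph: finite, simple, undirected, with at least one vertex. -/
structure FinGraph where
  V : Type
  [finite : Finite V]
  [nonempty : Nonempty V]
  graph : SimpleGraph V

attribute [instance] FinGraph.finite FinGraph.nonempty

namespace FinGraph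

/-- Two graphs are isomorphic. -/
def Iso (G H : FinGraph) : Prop := Nonempty (G.graph ≃g H.graph)

/-- The order `|V(G)|` of a graph. -/
noncomputable def order (G : FinGraph) : ℕ := Nat.card G.V

/-- `S` is an `a,b`-separator of `G`: it avoids `a` and `b`, which lie in different
connected components of `G - S`. -/
def IsSeparator {V : Type} (G : SimpleGraph V) (a b : V) (S : Set V) : Prop :=
  ∃ (ha : a ∈ Sᶜ) (hb : b ∈ Sᶜ),
    (G.induce Sᶜ).connectedComponentMk ⟨a, ha⟩ ≠ (G.induce Sᶜ).connectedComponentMk ⟨b, hb⟩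

/-- `S` is a minimal `a,b`-separator: no proper subset of it is an `a,b`-separator. -/
def IsMinSeparatorOf {V : Type} (G : SimpleGraph V) (a b : V) (S : Set V) : Prop :=
  IsSeparator G a b S ∧ ∀ T : Set V, T ⊂ S → ¬ IsSeparator G a b T

/-- The set of all minimal separators of `G`, that is, of all minimal `a,b`-separators, where
`a` and `b` range over the pairs of distinct non-adjacent vertices. -/
def minSeparators (G : FinGraph) : Set (Set G.V) :=
  {S | ∃ a b : G.V, a ≠ b ∧ ¬ G.graph.Adj a b ∧ IsMinSeparatorOf G.graph a b S}

/-- The number `s(G)` of minimal separators of `G`. -/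
noncomputable def numMinSeparators (G : FinGraph) : ℕ := G.minSeparators.ncard

/-- A class of graphs is tame if the number of minimal separators of its members is bounded by
a real polynomial in the number of vertices. -/
def Tame (C : Set FinGraph) : Prop :=
  ∃ p : Polynomial ℝ, ∀ G ∈ C, (G.numMinSeparators : ℝ) ≤ p.eval (G.order : ℝ)

/-- The class of `F`-free graphs: no induced subgraph is isomorphic to a member of `F`. -/
def freeClass (F : Set FinGraph) : Set FinGraph :=
  {G | ∀ H ∈ F, ¬ H.graph.IsIndContained G.graph}

/-- The relation `F ⊴ F'` between families of graphs: every `F`-free graph is `F'`-free. -/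
def FamilyLE (F F' : Set FinGraph) : Prop := freeClass F ⊆ freeClass F'

/-- Equality of families of graphs, where isomorphic graphs are identified. -/
def FamilyEq (F F' : Set FinGraph) : Prop :=
  (∀ H ∈ F, ∃ H' ∈ F', Iso H H') ∧ (∀ H' ∈ F', ∃ H ∈ F, Iso H H')

/-- Three isolated vertices. -/
def threeP1 : FinGraph := ⟨Fin 3, ⊥⟩

/-- Four isolated vertices. -/
def fourP1 : FinGraph := ⟨Fin 4, ⊥⟩

/-- The complete graph on three vertices. -/
def K3 : FinGraph := ⟨Fin 3, ⊤⟩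

/-- The complete graph on four vertices. -/
def K4 : FinGraph := ⟨Fin 4, ⊤⟩

/-- The cycle on four vertices. -/
def C4 : FinGraph := ⟨Fin 4, SimpleGraph.cycleGraph 4⟩

/-- The claw: the complete bipartite graph with parts of sizes one and three. -/
def claw : FinGraph := ⟨Fin 1 ⊕ Fin 3, completeBipartiteGraph (Fin 1) (Fin 3)⟩

/-- The diamond: the complete graph on four vertices minus one edge. -/
def diamond : FinGraph := ⟨Fin 4, (⊤ : SimpleGraph (Fin 4)).deleteEdges {s(0, 1)}⟩

end FinGraph

/-!
A minimal separator `S` is the common boundary of two disjoint connected sets `A` and `B`. If some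
`T ⊆ A` dominates `S`, then `S` can be recovered from `T` and any `b ∈ B`, as the boundary of the
component of `b` after deletion of the boundary of `T`. Hence a class in which a bounded number of
vertices of `A` or of `B` always dominates `S` is tame.

A graph with at most four vertices that is not an induced subgraph of `P₄` is, up to isomorphism,
`3P₁`, `K₃`, or one of ten four-vertex graphs. So if none of the three families lies below `F`, then
the `F`-free graphs avoid `P₄`, or `2K₂`, or one of `4P₁`, co-diamond, co-paw together with one of
paw, co-claw, `K₄`, `C₄`, or the claw together with the paw or the co-claw. Each of these forces
bounded domination, up to exchanging `A` and `B`. If cliques and independent sets in `A` are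
bounded, so is `A`, by Ramsey's theorem. For `C₄` the set `A` is a clique and the independent sets
in `S` are bounded: if `u ∈ S` has an inclusion-minimal neighbourhood in `A`, then each neighbour of
`u` in `A` dominates all neighbours of `u` in `S`, and one recurses on the non-neighbours of `u`.
For the claw, `A` is small or induces a path or a cycle, and only the ends of the path see `S`.

Conversely, join two copies of a graph `R` by a matching between the copies of a vertex set `I` such
that `R - I` is connected and dominates `I`. Choosing one end of each edge of the matching gives
`2 ^ |I|` minimal separators. Complete graphs, stars and strips of triangles as `R` account for
the families (i), (iii) and (ii).
-/

namespace FinGraph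

open SimpleGraph

section Separators

variable {V : Type*} {G : SimpleGraph V} {A B S T X Z : Set V} {a b c s v w : V}

/-- The outer vertex boundary of `A` in `G`: the vertices outside `A` with a neighbour in `A`. -/
def boundary (G : SimpleGraph V) (A : Set V) : Set V := {v | v ∉ A ∧ ∃ a ∈ A, G.Adj a v}

/-- The vertex set of the connected component of `G - Z` that contains `b`; it is empty when
`b ∈ Z`. -/
def component (G : SimpleGraph V) (Z : Set V) (b : V) : Set V :=
  {v | ∃ (hb : b ∈ Zᶜ) (hv : v ∈ Zᶜ), (G.induce Zᶜ).Reachable ⟨b, hb⟩ ⟨v, hv⟩}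

/-- `A` and `B` span two distinct connected components of `G - S`, both of them full: every vertex
of `S` has a neighbour in `A` and one in `B`. -/
structure IsFullPair (G : SimpleGraph V) (A B S : Set V) : Prop where
  connected_left : (G.induce A).Connected
  connected_right : (G.induce B).Connected
  disjoint : Disjoint A B
  boundary_left : boundary G A = S
  boundary_right : boundary G B = S

theorem subset_of_adj_closed (hA : (G.induce A).Preconnected) (ha : a ∈ A) (haX : a ∈ X)
    (hX : ∀ u ∈ A, u ∈ X → ∀ v ∈ A, G.Adj u v → v ∈ X) : A ⊆ X := by
  intro v hv
  by_contra hvX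
  obtain ⟨p⟩ := hA ⟨a, ha⟩ ⟨v, hv⟩
  obtain ⟨d, -, hd₁, hd₂⟩ := p.exists_boundary_dart (Subtype.val ⁻¹' X) haX hvX
  exact hd₂ (hX _ d.fst.2 hd₁ _ d.snd.2 d.adj)

theorem mem_component_self (hb : b ∉ Z) : b ∈ component G Z b := ⟨hb, hb, .rfl⟩

theorem mem_component_comm : a ∈ component G Z b ↔ b ∈ component G Z a :=
  ⟨fun ⟨hb, ha, h⟩ ↦ ⟨ha, hb, h.symm⟩, fun ⟨ha, hb, h⟩ ↦ ⟨hb, ha, h.symm⟩⟩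

theorem mem_component_trans : a ∈ component G Z b → b ∈ component G Z c → a ∈ component G Z c :=
  fun ⟨_, ha, hab⟩ ⟨hc, _, hbc⟩ ↦ ⟨hc, ha, hbc.trans hab⟩

theorem mem_component_of_adj (hv : v ∈ component G Z b) (hvw : G.Adj v w) (hw : w ∉ Z) :
    w ∈ component G Z b := by
  obtain ⟨hb, hv, hbv⟩ := hv
  have hvw' : (G.induce Zᶜ).Adj ⟨v, hv⟩ ⟨w, hw⟩ := hvw
  exact ⟨hb, hw, hbv.trans hvw'.reachable⟩

theorem boundary_component_subset : boundary G (component G Z b) ⊆ Z := by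
  rintro v ⟨hv, w, hw, hwv⟩
  by_contra hvZ
  exact hv (mem_component_of_adj hw hwv hvZ)

theorem component_subset (hb : b ∈ X) (hX : boundary G X ⊆ Z) : component G Z b ⊆ X := by
  rintro v ⟨_, _, ⟨p⟩⟩
  by_contra hvX
  obtain ⟨d, -, hd₁, hd₂⟩ := p.exists_boundary_dart (Subtype.val ⁻¹' X) hb hvX
  exact d.snd.2 (hX ⟨hd₂, _, hd₁, d.adj⟩)

theorem subset_component (hX : (G.induce X).Preconnected) (hb : b ∈ X) (hXZ : Disjoint X Z) :
    X ⊆ component G Z b :=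
  subset_of_adj_closed hX hb (mem_component_self (hXZ.notMem_of_mem_left hb))
    fun _ _ hu _ hv huv ↦ mem_component_of_adj hu huv (hXZ.notMem_of_mem_left hv)

theorem connected_induce_component (hb : b ∉ Z) : (G.induce (component G Z b)).Connected := by
  classical
  refine induce_connected_of_patches b (mem_component_self hb) ?_
  rintro v ⟨hb, _, ⟨p⟩⟩
  set q := p.map (Embedding.induce Zᶜ).toHom
  refine ⟨{u | u ∈ q.support}, fun u hu ↦ ?_, q.start_mem_support, q.end_mem_support,
    q.connected_induce_support _ _⟩
  obtain ⟨x, hx, rfl⟩ := List.mem_map.1 (p.support_map _ ▸ hu)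
  exact ⟨hb, x.2, ⟨p.takeUntil x hx⟩⟩

namespace IsFullPair

theorem symm (h : IsFullPair G A B S) : IsFullPair G B A S :=
  ⟨h.connected_right, h.connected_left, h.disjoint.symm, h.boundary_right, h.boundary_left⟩

theorem disjoint_left (h : IsFullPair G A B S) : Disjoint A S :=
  Set.disjoint_left.2 fun _ ha hs ↦ (h.boundary_left ▸ hs : _ ∈ boundary G A).1 ha

theorem exists_adj_left (h : IsFullPair G A B S) (hs : s ∈ S) : ∃ a ∈ A, G.Adj a s :=
  (h.boundary_left ▸ hs : s ∈ boundary G A).2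

theorem mem_separator_of_adj (h : IsFullPair G A B S) (ha : a ∈ A) (hv : v ∉ A)
    (hav : G.Adj a v) : v ∈ S :=
  h.boundary_left ▸ ⟨hv, a, ha, hav⟩

theorem not_adj (h : IsFullPair G A B S) (ha : a ∈ A) (hb : b ∈ B) : ¬ G.Adj a b := fun hab ↦
  h.symm.disjoint_left.notMem_of_mem_left hb
    (h.mem_separator_of_adj ha (h.disjoint.notMem_of_mem_right hb) hab)

theorem ne (h : IsFullPair G A B S) (ha : a ∈ A) (hb : b ∈ B) : a ≠ b :=
  h.disjoint.ne_of_mem ha hb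

theorem component_eq (h : IsFullPair G A B S) (hb : b ∈ B) (hSZ : S ⊆ Z) (hBZ : Disjoint B Z) :
    component G Z b = B :=
  (component_subset hb (h.boundary_right.trans_subset hSZ)).antisymm
    (subset_component h.connected_right.preconnected hb hBZ)

theorem mem_component (h : IsFullPair G A B S) (ha : a ∈ A) (hTS : T ⊆ S) (hs : s ∈ S)
    (hsT : s ∉ T) : s ∈ component G T a := by
  obtain ⟨x, hx, hxs⟩ := h.exists_adj_left hs
  exact mem_component_of_adj
    (subset_component h.connected_left.preconnected ha (h.disjoint_left.mono_right hTS) hx) hxs hsT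

end IsFullPair

end Separators

section MinimalSeparators

variable {V : Type} {G : SimpleGraph V} {A B S : Set V} {a b : V}

theorem isSeparator_iff :
    IsSeparator G a b S ↔ a ∉ S ∧ b ∉ S ∧ b ∉ component G S a := by
  simp only [IsSeparator, component, Set.mem_compl_iff, ne_eq, ConnectedComponent.eq,
    Set.mem_ofPred_eq]
  grind

theorem IsMinSeparatorOf.symm (h : IsMinSeparatorOf G a b S) : IsMinSeparatorOf G b a S := by
  have comm (T : Set V) : IsSeparator G a b T ↔ IsSeparator G b a T := by
    rw [isSeparator_iff, isSeparator_iff, mem_component_comm]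
    tauto
  simpa only [IsMinSeparatorOf, comm] using h

theorem IsMinSeparatorOf.boundary_component (h : IsMinSeparatorOf G a b S) :
    boundary G (component G S a) = S := by
  obtain ⟨ha, hb, hab⟩ := isSeparator_iff.1 h.1
  refine eq_of_subset_of_not_ssubset boundary_component_subset fun hssub ↦ h.2 _ hssub ?_
  exact isSeparator_iff.2 ⟨fun h ↦ ha (hssub.subset h), fun h ↦ hb (hssub.subset h),
    fun h ↦ hab (component_subset (mem_component_self ha) subset_rfl h)⟩

theorem IsMinSeparatorOf.isFullPair (h : IsMinSeparatorOf G a b S) :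
    IsFullPair G (component G S a) (component G S b) S := by
  obtain ⟨ha, hb, hab⟩ := isSeparator_iff.1 h.1
  refine ⟨connected_induce_component ha, connected_induce_component hb,
    Set.disjoint_left.2 fun x hxa hxb ↦ hab ?_, h.boundary_component, h.symm.boundary_component⟩
  exact mem_component_trans (mem_component_comm.1 hxb) hxa

theorem IsFullPair.isMinSeparatorOf (h : IsFullPair G A B S) (ha : a ∈ A) (hb : b ∈ B) :
    IsMinSeparatorOf G a b S := by
  refine ⟨isSeparator_iff.2 ⟨h.disjoint_left.notMem_of_mem_left ha,
    h.symm.disjoint_left.notMem_of_mem_left hb, fun hab ↦ ?_⟩, fun T hT hsep ↦ ?_⟩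
  · exact h.disjoint.notMem_of_mem_right hb (component_subset ha h.boundary_left.subset hab)
  · obtain ⟨s, hs, hsT⟩ := Set.exists_of_ssubset hT
    exact (isSeparator_iff.1 hsep).2.2 <| mem_component_trans
      (mem_component_comm.1 (h.symm.mem_component hb hT.subset hs hsT))
      (h.mem_component ha hT.subset hs hsT)

theorem mem_minSeparators_iff {G : FinGraph} {S : Set G.V} :
    S ∈ G.minSeparators ↔ ∃ A B, IsFullPair G.graph A B S := by
  constructor
  · rintro ⟨a, b, -, -, h⟩
    exact ⟨_, _, h.isFullPair⟩
  · rintro ⟨A, B, h⟩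
    obtain ⟨a, ha⟩ := h.connected_left.nonempty
    obtain ⟨b, hb⟩ := h.connected_right.nonempty
    exact ⟨a, b, h.ne ha hb, h.not_adj ha hb, h.isMinSeparatorOf ha hb⟩

end MinimalSeparators

section Domination

variable {V : Type*} {G : SimpleGraph V} {A B S : Set V} {K L : ℕ}

/-- At most `K` vertices of `A` suffice to dominate `S`. A full pair whose separator is dominated
in this way is determined by the dominating set and one vertex on the other side. -/
def Dominated (G : SimpleGraph V) (K : ℕ) (A S : Set V) : Prop :=
  ∃ T : Finset V, ↑T ⊆ A ∧ T.card ≤ K ∧ ∀ s ∈ S, ∃ t ∈ T, G.Adj t s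

theorem Dominated.mono (hKL : K ≤ L) : Dominated G K A S → Dominated G L A S :=
  fun ⟨T, hTA, hT, hTS⟩ ↦ ⟨T, hTA, hT.trans hKL, hTS⟩

theorem IsFullPair.boundary_component_boundary (h : IsFullPair G A B S) {T : Set V} (hTA : T ⊆ A)
    (hTS : ∀ s ∈ S, ∃ t ∈ T, G.Adj t s) {b : V} (hb : b ∈ B) :
    boundary G (component G (boundary G T) b) = S := by
  have hST : S ⊆ boundary G T := fun s hs ↦
    ⟨fun hsT ↦ h.disjoint_left.notMem_of_mem_left (hTA hsT) hs, hTS s hs⟩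
  have hBT : Disjoint B (boundary G T) := Set.disjoint_left.2 fun x hxB ⟨_, t, ht, htx⟩ ↦
    h.not_adj (hTA ht) hxB htx
  rw [h.component_eq hb hST hBT, h.boundary_right]

theorem IsFullPair.mem_range_of_dominated (h : IsFullPair G A B S) (hd : Dominated G K A S) :
    S ∈ Set.range fun x : (Fin K → Option V) × V ↦
      boundary G (component G (boundary G {v | ∃ i, x.1 i = some v}) x.2) := by
  obtain ⟨T, hTA, hTK, hTS⟩ := hd
  obtain ⟨b, hb⟩ := h.connected_right.nonempty
  have hT : {v | ∃ i : Fin K, T.toList[(i : ℕ)]? = some v} = T := by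
    ext v
    rw [Finset.mem_coe, ← Finset.mem_toList, List.mem_iff_getElem?]
    refine ⟨fun ⟨i, hi⟩ ↦ ⟨i, hi⟩, fun ⟨i, hi⟩ ↦ ⟨⟨i, ?_⟩, hi⟩⟩
    obtain ⟨hi, -⟩ := List.getElem?_eq_some_iff.1 hi
    exact (T.length_toList ▸ hi).trans_le hTK
  refine ⟨(fun i ↦ T.toList[(i : ℕ)]?, b), ?_⟩
  simpa only [hT] using h.boundary_component_boundary hTA hTS hb

theorem tame_of_dominated {C : Set FinGraph} (K : ℕ)
    (hC : ∀ G ∈ C, ∀ A B S, IsFullPair G.graph A B S →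
      Dominated G.graph K A S ∨ Dominated G.graph K B S) : Tame C := by
  refine ⟨(.X + 1) ^ K * .X, fun G hG ↦ ?_⟩
  have hsub : G.minSeparators ⊆ Set.range fun x : (Fin K → Option G.V) × G.V ↦
      boundary G.graph (component G.graph (boundary G.graph {v | ∃ i, x.1 i = some v}) x.2) := by
    intro S hS
    obtain ⟨A, B, h⟩ := mem_minSeparators_iff.1 hS
    exact (hC G hG A B S h).elim h.mem_range_of_dominated h.symm.mem_range_of_dominated
  have hcard : G.numMinSeparators ≤ (G.order + 1) ^ K * G.order := by
    refine (Set.ncard_le_ncard hsub).trans ((Finite.card_range_le _).trans_eq ?_)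
    rw [Nat.card_prod, Nat.card_fun, Nat.card_fin, Finite.card_option, order]
  simpa using (Nat.cast_le (α := ℝ)).2 hcard

theorem Tame.mono {C D : Set FinGraph} (hCD : C ⊆ D) : Tame D → Tame C :=
  fun ⟨p, hp⟩ ↦ ⟨p, fun G hG ↦ hp G (hCD hG)⟩

end Domination

section Patterns

variable {V : Type*} {G : SimpleGraph V}

/-- The graph on four vertices in which `a, b, c, d, e, f` tell whether the pairs
`01, 02, 03, 12, 13, 23` are edges; every graph with four vertices is isomorphic to one of these. -/
def quad (a b c d e f : Bool) : FinGraph where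
  V := Fin 4
  graph :=
    { Adj i j := (![![false, a, b, c], ![a, false, d, e], ![b, d, false, f], ![c, e, f, false]] :
        Fin 4 → Fin 4 → Bool) i j
      symm := ⟨by decide +revert⟩
      loopless := ⟨by decide +revert⟩ }

instance (a b c d e f : Bool) : Fintype (quad a b c d e f).V := inferInstanceAs (Fintype (Fin 4))

instance (a b c d e f : Bool) : DecidableEq (quad a b c d e f).V :=
  inferInstanceAs (DecidableEq (Fin 4))

instance (a b c d e f : Bool) : DecidableRel (quad a b c d e f).graph.Adj :=
  fun _ _ ↦ inferInstanceAs (Decidable (_ = true))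

/-- The path on four vertices. -/
def P4 : FinGraph := quad true false false true false true

/-- Two disjoint edges. -/
def twoK2 : FinGraph := quad true false false false false true

/-- The complement of the diamond: an edge and two isolated vertices. -/
def coDiamond : FinGraph := quad true false false false false false

/-- The complement of the paw: a path on three vertices and an isolated vertex. -/
def coPaw : FinGraph := quad true false false true false false

/-- The complement of the claw: a triangle and an isolated vertex. -/
def coClaw : FinGraph := quad true true false true false false

/-- The paw: a triangle with a pendant edge. -/
def paw : FinGraph := quad true true true true false false

theorem isIndContained_iff_exists {n : ℕ} {H : SimpleGraph (Fin n)} :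
    H ⊴ G ↔ ∃ φ : Fin n → V, ∀ i j, i < j → φ i ≠ φ j ∧ (G.Adj (φ i) (φ j) ↔ H.Adj i j) := by
  constructor
  · rintro ⟨φ⟩
    exact ⟨φ, fun i j hij ↦ ⟨φ.injective.ne hij.ne, φ.map_adj_iff⟩⟩
  · rintro ⟨φ, hφ⟩
    have hinj : φ.Injective := fun i j hij ↦ by
      by_contra hne
      exact (lt_or_gt_of_ne hne).elim (fun h ↦ (hφ i j h).1 hij) fun h ↦ (hφ j i h).1 hij.symm
    have hadj (i j : Fin n) : G.Adj (φ i) (φ j) ↔ H.Adj i j := by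
      rcases lt_trichotomy i j with h | rfl | h
      · exact (hφ i j h).2
      · simp
      · simpa only [adj_comm] using (hφ j i h).2
    exact ⟨⟨φ, hinj⟩, hadj _ _⟩

theorem quad_isIndContained_iff {a b c d e f : Bool} :
    (quad a b c d e f).graph ⊴ G ↔ ∃ x y z w : V,
      (x ≠ y ∧ x ≠ z ∧ x ≠ w ∧ y ≠ z ∧ y ≠ w ∧ z ≠ w) ∧
      (G.Adj x y ↔ a) ∧ (G.Adj x z ↔ b) ∧ (G.Adj x w ↔ c) ∧
      (G.Adj y z ↔ d) ∧ (G.Adj y w ↔ e) ∧ (G.Adj z w ↔ f) := by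
  refine (isIndContained_iff_exists (n := 4)).trans ⟨?_, ?_⟩
  · rintro ⟨φ, hφ⟩
    refine ⟨φ 0, φ 1, φ 2, φ 3, ?_⟩
    have h (i j : Fin 4) (hij : i < j := by decide) := hφ i j hij
    exact ⟨⟨(h 0 1).1, (h 0 2).1, (h 0 3).1, (h 1 2).1, (h 1 3).1, (h 2 3).1⟩,
      (h 0 1).2, (h 0 2).2, (h 0 3).2, (h 1 2).2, (h 1 3).2, (h 2 3).2⟩
  · rintro ⟨x, y, z, w, hne, hadj⟩
    refine ⟨![x, y, z, w], fun i j hij ↦ ?_⟩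
    fin_cases i <;> fin_cases j <;> simp_all [quad]

theorem fourP1_iso_quad : Iso fourP1 (quad false false false false false false) :=
  ⟨.refl _, by simp only [fourP1, quad]; decide⟩

theorem K4_iso_quad : Iso K4 (quad true true true true true true) :=
  ⟨.refl _, by simp only [K4, quad]; decide⟩

theorem C4_iso_quad : Iso C4 (quad true false true true false true) :=
  ⟨.refl _, by simp only [C4, quad, cycleGraph_adj]; decide⟩

theorem diamond_iso_quad : Iso diamond (quad false true true true true true) :=
  ⟨.refl _, by simp only [diamond, quad, deleteEdges_adj]; decide⟩

theorem claw_iso_quad : Iso claw (quad true true true false false false) :=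
  ⟨finSumFinEquiv, by simp only [claw, quad, completeBipartiteGraph_adj]; decide⟩

theorem Iso.isIndContained_iff {H K : FinGraph} (h : Iso H K) : H.graph ⊴ G ↔ K.graph ⊴ G :=
  have ⟨e⟩ := h
  ⟨e.isIndContained'.trans, e.isIndContained.trans⟩

theorem not_isIndContained_K3_iff : ¬ K3.graph ⊴ G ↔ G.CliqueFree 3 := by
  rw [K3, top_isIndContained_iff_top_isContained, ← not_cliqueFree_iff_top_isContained, not_not]

theorem K3_isIndContained_iff :
    K3.graph ⊴ G ↔ ∃ x y z : V, G.Adj x y ∧ G.Adj x z ∧ G.Adj y z := by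
  classical
  rw [← not_iff_not, not_isIndContained_K3_iff]
  simp only [CliqueFree, is3Clique_iff]
  grind

theorem not_isIndContained_K4_iff : ¬ K4.graph ⊴ G ↔ G.CliqueFree 4 := by
  rw [K4, top_isIndContained_iff_top_isContained, ← not_cliqueFree_iff_top_isContained, not_not]

theorem threeP1_isIndContained_iff :
    threeP1.graph ⊴ G ↔ ∃ x y z : V,
      (x ≠ y ∧ x ≠ z ∧ y ≠ z) ∧ ¬ G.Adj x y ∧ ¬ G.Adj x z ∧ ¬ G.Adj y z := by
  rw [threeP1, isIndContained_iff_exists]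
  constructor
  · rintro ⟨φ, hφ⟩
    have h (i j : Fin 3) (hij : i < j := by decide) := hφ i j hij
    exact ⟨φ 0, φ 1, φ 2, ⟨(h 0 1).1, (h 0 2).1, (h 1 2).1⟩,
      (h 0 1).2.1, (h 0 2).2.1, (h 1 2).2.1⟩
  · rintro ⟨x, y, z, hne, hadj⟩
    refine ⟨![x, y, z], fun i j hij ↦ ?_⟩
    fin_cases i <;> fin_cases j <;> simp_all

section Free

variable {x y z w : V}

theorem adj_of_P4_free (h : ¬ P4.graph ⊴ G) (hxy : G.Adj x y) (hyz : G.Adj y z)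
    (hzw : G.Adj z w) : G.Adj x z ∨ G.Adj x w ∨ G.Adj y w := by
  by_contra! hno
  exact h (quad_isIndContained_iff.2 ⟨x, y, z, w, by grind [SimpleGraph.Adj.symm, G.irrefl]⟩)

theorem adj_of_twoK2_free (h : ¬ twoK2.graph ⊴ G) (hxy : G.Adj x y) (hzw : G.Adj z w) :
    G.Adj x z ∨ G.Adj x w ∨ G.Adj y z ∨ G.Adj y w := by
  by_contra! hno
  exact h (quad_isIndContained_iff.2 ⟨x, y, z, w, by grind [SimpleGraph.Adj.symm, G.irrefl]⟩)

theorem adj_of_fourP1_free (h : ¬ fourP1.graph ⊴ G) (hxy : x ≠ y) (hxz : x ≠ z) (hxw : x ≠ w)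
    (hyz : y ≠ z) (hyw : y ≠ w) (hzw : z ≠ w) :
    G.Adj x y ∨ G.Adj x z ∨ G.Adj x w ∨ G.Adj y z ∨ G.Adj y w ∨ G.Adj z w := by
  by_contra! hno
  rw [fourP1_iso_quad.isIndContained_iff, quad_isIndContained_iff] at h
  exact h ⟨x, y, z, w, by grind⟩

theorem adj_of_coDiamond_free (h : ¬ coDiamond.graph ⊴ G) (hxy : G.Adj x y) (hzw : z ≠ w) :
    G.Adj x z ∨ G.Adj x w ∨ G.Adj y z ∨ G.Adj y w ∨ G.Adj z w := by
  by_contra! hno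
  exact h (quad_isIndContained_iff.2 ⟨x, y, z, w, by grind [SimpleGraph.Adj.symm, G.irrefl]⟩)

theorem adj_of_coPaw_free (h : ¬ coPaw.graph ⊴ G) (hxy : G.Adj x y) (hyz : G.Adj y z)
    (hxz : x ≠ z) : G.Adj x z ∨ G.Adj x w ∨ G.Adj y w ∨ G.Adj z w := by
  by_contra! hno
  exact h (quad_isIndContained_iff.2 ⟨x, y, z, w, by grind [SimpleGraph.Adj.symm, G.irrefl]⟩)

theorem adj_of_coClaw_free (h : ¬ coClaw.graph ⊴ G) (hxy : G.Adj x y) (hxz : G.Adj x z)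
    (hyz : G.Adj y z) (w : V) : G.Adj x w ∨ G.Adj y w ∨ G.Adj z w := by
  by_contra! hno
  exact h (quad_isIndContained_iff.2 ⟨x, y, z, w, by grind [SimpleGraph.Adj.symm, G.irrefl]⟩)

theorem adj_of_paw_free (h : ¬ paw.graph ⊴ G) (hxy : G.Adj x y) (hxz : G.Adj x z)
    (hyz : G.Adj y z) (hxw : G.Adj x w) : G.Adj y w ∨ G.Adj z w := by
  by_contra! hno
  exact h (quad_isIndContained_iff.2 ⟨x, y, z, w, by grind [SimpleGraph.Adj.symm, G.irrefl]⟩)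

theorem adj_of_C4_free (h : ¬ C4.graph ⊴ G) (hxy : G.Adj x y) (hyz : G.Adj y z)
    (hzw : G.Adj z w) (hwx : G.Adj w x) (hxz : x ≠ z) (hyw : y ≠ w) :
    G.Adj x z ∨ G.Adj y w := by
  by_contra! hno
  rw [C4_iso_quad.isIndContained_iff, quad_isIndContained_iff] at h
  exact h ⟨x, y, z, w, by grind [SimpleGraph.Adj.symm, G.irrefl]⟩

theorem adj_of_claw_free (h : ¬ claw.graph ⊴ G) (hxy : G.Adj x y) (hxz : G.Adj x z)
    (hxw : G.Adj x w) (hyz : y ≠ z) (hyw : y ≠ w) (hzw : z ≠ w) :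
    G.Adj y z ∨ G.Adj y w ∨ G.Adj z w := by
  by_contra! hno
  rw [claw_iso_quad.isIndContained_iff, quad_isIndContained_iff] at h
  exact h ⟨x, y, z, w, by grind [SimpleGraph.Adj.symm, G.irrefl]⟩

end Free

end Patterns

section Classification

variable {F F' : Set FinGraph} {G H K : FinGraph}

theorem Iso.symm (h : Iso H K) : Iso K H := have ⟨e⟩ := h; ⟨e.symm⟩

theorem iso_of_isIndContained (h : H.graph ⊴ K.graph) (hcard : H.order = K.order) : Iso H K :=
  have ⟨φ⟩ := h
  ⟨RelIso.ofSurjective φ ((Nat.bijective_iff_injective_and_card φ).2 ⟨φ.injective, hcard⟩).2⟩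

theorem exists_iso_quad (h : H.order = 4) : ∃ a b c d e f, Iso H (quad a b c d e f) := by
  classical
  have e := (Finite.equivFinOfCardEq h).symm
  have key : ∃ a b c d e f, (quad a b c d e f).graph ⊴ H.graph := by
    simp only [quad_isIndContained_iff]
    exact ⟨_, _, _, _, _, _, e 0, e 1, e 2, e 3, by simp, decide_eq_true_iff.symm,
      decide_eq_true_iff.symm, decide_eq_true_iff.symm, decide_eq_true_iff.symm,
      decide_eq_true_iff.symm, decide_eq_true_iff.symm⟩
  obtain ⟨a, b, c, d, e, f, hq⟩ := key
  exact ⟨a, b, c, d, e, f, (iso_of_isIndContained hq (by rw [h]; exact Nat.card_fin 4)).symm⟩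

set_option synthInstance.maxSize 2000 in
theorem exists_pattern_isIndContained_quad (a b c d e f : Bool) :
    ∃ P ∈ ({P4, twoK2, fourP1, coDiamond, coPaw, claw, coClaw, paw, diamond, K4, C4} :
      Set FinGraph), P.graph ⊴ (quad a b c d e f).graph := by
  simp only [Set.mem_insert_iff, Set.mem_singleton_iff, exists_eq_or_imp, exists_eq_left,
    fourP1_iso_quad.isIndContained_iff, claw_iso_quad.isIndContained_iff,
    diamond_iso_quad.isIndContained_iff, K4_iso_quad.isIndContained_iff,
    C4_iso_quad.isIndContained_iff, P4, twoK2, coDiamond, coPaw, coClaw, paw,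
    quad_isIndContained_iff, ← exists_or, ← and_or_left]
  decide +kernel +revert

theorem threeP1_isIndContained_of_mem {P : FinGraph}
    (hP : P ∈ ({threeP1, fourP1, coDiamond, coPaw, claw} : Set FinGraph)) :
    threeP1.graph ⊴ P.graph := by
  rcases hP with rfl | rfl | rfl | rfl | rfl
  · exact .rfl
  · rw [threeP1_isIndContained_iff, fourP1]; decide
  · rw [threeP1_isIndContained_iff, coDiamond]; decide
  · rw [threeP1_isIndContained_iff, coPaw]; decide
  · rw [threeP1_isIndContained_iff]; exact ⟨.inr 0, .inr 1, .inr 2, by simp [claw]⟩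

theorem exists_triple_P4 (a b c : Bool) (h : ¬ (a = b ∧ a = c)) :
    ∃ x y z : P4.V, (x ≠ y ∧ x ≠ z ∧ y ≠ z) ∧
      (P4.graph.Adj x y ↔ a) ∧ (P4.graph.Adj x z ↔ b) ∧ (P4.graph.Adj y z ↔ c) := by
  unfold P4
  revert h
  cases a <;> cases b <;> cases c <;> decide

theorem isIndContained_P4_fin_one (G : SimpleGraph (Fin 1)) : G ⊴ P4.graph :=
  isIndContained_iff_exists.2
    ⟨fun _ ↦ (0 : Fin 4), fun _ _ hij ↦ (hij.ne (Subsingleton.elim _ _)).elim⟩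

theorem isIndContained_P4_fin_two (G : SimpleGraph (Fin 2)) : G ⊴ P4.graph := by
  rw [isIndContained_iff_exists]
  by_cases h : G.Adj 0 1
  · refine ⟨![(0 : Fin 4), (1 : Fin 4)], fun i j hij ↦ ?_⟩
    fin_cases i <;> fin_cases j <;> simp_all [P4, quad]
  · refine ⟨![(0 : Fin 4), (2 : Fin 4)], fun i j hij ↦ ?_⟩
    fin_cases i <;> fin_cases j <;> simp_all [P4, quad]

theorem isIndContained_P4_fin_three {G : SimpleGraph (Fin 3)} (hbot : G ≠ ⊥) (htop : G ≠ ⊤) :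
    G ⊴ P4.graph := by
  classical
  have hG : ¬ ((G.Adj 0 1 ↔ G.Adj 0 2) ∧ (G.Adj 0 1 ↔ G.Adj 1 2)) := fun heq ↦ by
    have hsymm (i j) : G.Adj i j ↔ G.Adj j i := G.adj_comm i j
    have hconst (i j : Fin 3) (hij : i ≠ j) : G.Adj i j ↔ G.Adj 0 1 := by
      fin_cases i <;> fin_cases j <;> grind
    by_cases h : G.Adj 0 1
    · exact htop (by ext i j; grind [G.irrefl, top_adj])
    · exact hbot (by ext i j; grind [G.irrefl, bot_adj])
  obtain ⟨x, y, z, hne, hadj⟩ :=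
    exists_triple_P4 (G.Adj 0 1) (G.Adj 0 2) (G.Adj 1 2) (by simpa using hG)
  refine isIndContained_iff_exists.2 ⟨![x, y, z], fun i j hij ↦ ?_⟩
  fin_cases i <;> fin_cases j <;> simp_all

theorem order_eq_four {P : FinGraph} (hP : P ∈ ({P4, twoK2, fourP1, coDiamond, coPaw, claw,
    coClaw, paw, diamond, K4, C4} : Set FinGraph)) : P.order = 4 := by
  rcases hP with rfl | rfl | rfl | rfl | rfl | rfl | rfl | rfl | rfl | rfl | rfl
  case inr.inr.inr.inr.inr.inl => simp [order, claw]
  all_goals exact Nat.card_fin 4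

theorem isIndContained_P4_or_iso (hH : H.order ≤ 4) :
    H.graph ⊴ P4.graph ∨ ∃ P ∈ ({threeP1, K3, twoK2, fourP1, coDiamond, coPaw, claw, coClaw, paw,
      diamond, K4, C4} : Set FinGraph), Iso P H := by
  have hpos : 0 < H.order := Nat.card_pos
  have hfin (n : ℕ) (hn : H.order = n) : ∃ G : SimpleGraph (Fin n), Nonempty (H.graph ≃g G) :=
    ⟨_, ⟨(Iso.comap (Finite.equivFinOfCardEq hn).symm H.graph).symm⟩⟩
  interval_cases hn : H.order
  · obtain ⟨G, ⟨e⟩⟩ := hfin 1 rfl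
    exact .inl (e.isIndContained.trans (isIndContained_P4_fin_one G))
  · obtain ⟨G, ⟨e⟩⟩ := hfin 2 rfl
    exact .inl (e.isIndContained.trans (isIndContained_P4_fin_two G))
  · obtain ⟨G, ⟨e⟩⟩ := hfin 3 rfl
    by_cases hbot : G = ⊥
    · subst hbot
      exact .inr ⟨threeP1, by simp, ⟨e.symm⟩⟩
    by_cases htop : G = ⊤
    · subst htop
      exact .inr ⟨K3, by simp, ⟨e.symm⟩⟩
    exact .inl (e.isIndContained.trans (isIndContained_P4_fin_three hbot htop))
  · obtain ⟨a, b, c, d, e, f, hH⟩ := exists_iso_quad hn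
    obtain ⟨P, hP, hPq⟩ := exists_pattern_isIndContained_quad a b c d e f
    have ⟨i⟩ := hH
    have hPH : P.graph ⊴ H.graph := hPq.trans i.isIndContained'
    have hiso := iso_of_isIndContained hPH (by rw [order_eq_four hP, hn])
    rcases hP with rfl | hP
    · have ⟨i⟩ := hiso
      exact .inl i.isIndContained'
    · exact .inr ⟨P, .inr (.inr hP), hiso⟩

theorem notMem_freeClass_of_isIndContained (h : H.graph ⊴ G.graph) (hH : H ∉ freeClass F) :
    G ∉ freeClass F := fun hG ↦
  hH fun K hK hKH ↦ hG K hK (hKH.trans h)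

theorem not_isIndContained_of_notMem_freeClass (hG : G ∈ freeClass F) (hH : H ∉ freeClass F) :
    ¬ H.graph ⊴ G.graph := fun h ↦
  notMem_freeClass_of_isIndContained h hH hG

theorem freeClass_subset_freeClass (h : ∀ H ∈ F', H ∉ freeClass F) : freeClass F ⊆ freeClass F' :=
  fun _ hG H hH ↦ not_isIndContained_of_notMem_freeClass hG (h H hH)

theorem exists_notMem_of_not_familyLE (hF : ∀ H ∈ F, H.order ≤ 4)
    (h : ¬ FamilyLE F' F) :
    P4 ∉ freeClass F ∨ ∃ P ∈ ({threeP1, K3, twoK2, fourP1, coDiamond, coPaw, claw, coClaw, paw,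
      diamond, K4, C4} : Set FinGraph), P ∈ freeClass F' ∧ P ∉ freeClass F := by
  obtain ⟨G, hGF', hGF⟩ := Set.not_subset.1 h
  obtain ⟨H, hHF, hHG⟩ : ∃ H ∈ F, H.graph ⊴ G.graph := by simpa [freeClass] using hGF
  have hH : H ∉ freeClass F := fun h ↦ h H hHF .rfl
  refine (isIndContained_P4_or_iso (hF H hHF)).imp
    (notMem_freeClass_of_isIndContained · hH) fun ⟨P, hP, ⟨e⟩⟩ ↦ ⟨P, hP, fun K hK hKP ↦ ?_, ?_⟩
  · exact hGF' K hK ((hKP.trans e.isIndContained).trans hHG)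
  · exact notMem_freeClass_of_isIndContained e.isIndContained' hH

theorem K3_isIndContained_of_mem {P : FinGraph}
    (hP : P ∈ ({K3, coClaw, paw, diamond, K4} : Set FinGraph)) : K3.graph ⊴ P.graph := by
  rcases hP with rfl | rfl | rfl | rfl | rfl
  · exact .rfl
  · rw [K3_isIndContained_iff, coClaw]; decide
  · rw [K3_isIndContained_iff, paw]; decide
  · rw [K3_isIndContained_iff]; exact ⟨(0 : Fin 4), (2 : Fin 4), (3 : Fin 4), by simp [diamond]⟩
  · rw [K3_isIndContained_iff, K4]; decide

theorem coDiamond_notMem_freeClass (h : threeP1 ∉ freeClass F) : coDiamond ∉ freeClass F :=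
  notMem_freeClass_of_isIndContained (threeP1_isIndContained_of_mem (by simp)) h

theorem paw_notMem_freeClass (h : K3 ∉ freeClass F) : paw ∉ freeClass F :=
  notMem_freeClass_of_isIndContained (K3_isIndContained_of_mem (by simp)) h

theorem exists_notMem_of_not_familyLE_threeP1_diamond (hF : ∀ H ∈ F, H.order ≤ 4)
    (h : ¬ FamilyLE {threeP1, diamond} F) :
    (∃ P ∈ ({P4, twoK2} : Set FinGraph), P ∉ freeClass F) ∨
      ∃ P ∈ ({paw, coClaw, K4, C4} : Set FinGraph), P ∉ freeClass F := by
  rcases exists_notMem_of_not_familyLE hF h with hP4 | ⟨P, hP, hPF', hPF⟩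
  · exact .inl ⟨P4, by simp, hP4⟩
  have hthreeP1 := mt threeP1_isIndContained_of_mem (hPF' threeP1 (by simp))
  have hdiamond : P ≠ diamond := by rintro rfl; exact hPF' diamond (by simp) .rfl
  simp only [Set.mem_insert_iff, Set.mem_singleton_iff] at hP hthreeP1 ⊢
  grind [paw_notMem_freeClass]

theorem exists_notMem_of_not_familyLE_claw_K4_C4_diamond (hF : ∀ H ∈ F, H.order ≤ 4)
    (h : ¬ FamilyLE {claw, K4, C4, diamond} F) :
    (∃ P ∈ ({P4, twoK2} : Set FinGraph), P ∉ freeClass F) ∨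
      (∃ P ∈ ({fourP1, coDiamond, coPaw} : Set FinGraph), P ∉ freeClass F) ∨
      ∃ P ∈ ({paw, coClaw} : Set FinGraph), P ∉ freeClass F := by
  rcases exists_notMem_of_not_familyLE hF h with hP4 | ⟨P, hP, hPF', hPF⟩
  · exact .inl ⟨P4, by simp, hP4⟩
  have hne : ∀ Q ∈ ({claw, K4, C4, diamond} : Set FinGraph), P ≠ Q := by
    rintro _ hQ rfl
    exact hPF' _ hQ .rfl
  simp only [Set.mem_insert_iff, Set.mem_singleton_iff] at hP hne ⊢
  grind [paw_notMem_freeClass, coDiamond_notMem_freeClass]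

theorem exists_notMem_of_not_familyLE_K3_C4 (hF : ∀ H ∈ F, H.order ≤ 4)
    (h : ¬ FamilyLE {K3, C4} F) :
    (∃ P ∈ ({P4, twoK2} : Set FinGraph), P ∉ freeClass F) ∨
      (∃ P ∈ ({fourP1, coDiamond, coPaw} : Set FinGraph), P ∉ freeClass F) ∨
      claw ∉ freeClass F := by
  rcases exists_notMem_of_not_familyLE hF h with hP4 | ⟨P, hP, hPF', hPF⟩
  · exact .inl ⟨P4, by simp, hP4⟩
  have hK3 := mt K3_isIndContained_of_mem (hPF' K3 (by simp))
  have hC4 : P ≠ C4 := by rintro rfl; exact hPF' C4 (by simp) .rfl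
  simp only [Set.mem_insert_iff, Set.mem_singleton_iff] at hP hK3 ⊢
  grind [coDiamond_notMem_freeClass]

end Classification

section Sides

variable {V : Type*} {G : SimpleGraph V} {A B S : Set V} {a s x y : V} {n : ℕ}

theorem indepSetFreeOn_iff_compl : G.IndepSetFreeOn A n ↔ Gᶜ.CliqueFreeOn A n := by
  simp only [IndepSetFreeOn, CliqueFreeOn, isNClique_compl]

theorem cliqueFreeOn_three_iff : G.CliqueFreeOn A 3 ↔
    ∀ x ∈ A, ∀ y ∈ A, ∀ z ∈ A, G.Adj x y → G.Adj x z → ¬ G.Adj y z := by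
  classical
  refine ⟨fun h x hx y hy z hz hxy hxz hyz ↦ h (t := {x, y, z}) ?_
    (is3Clique_triple_iff.2 ⟨hxy, hxz, hyz⟩), fun h t ht hcl ↦ ?_⟩
  · simp [Set.insert_subset_iff, hx, hy, hz]
  · obtain ⟨x, y, z, hxy, hxz, hyz, rfl⟩ := is3Clique_iff.1 hcl
    simp only [Finset.coe_insert, Finset.coe_singleton, Set.insert_subset_iff,
      Set.singleton_subset_iff] at ht
    exact h x ht.1 y ht.2.1 z ht.2.2 hxy hxz hyz

theorem indepSetFreeOn_three_iff : G.IndepSetFreeOn A 3 ↔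
    ∀ x ∈ A, ∀ y ∈ A, ∀ z ∈ A, x ≠ y → x ≠ z → y ≠ z → G.Adj x y ∨ G.Adj x z ∨ G.Adj y z := by
  rw [indepSetFreeOn_iff_compl, cliqueFreeOn_three_iff]
  simp only [compl_adj]
  grind

theorem IsFullPair.dominated_of_ncard_le [Finite V] (h : IsFullPair G A B S) {K : ℕ}
    (hA : A.ncard ≤ K) : Dominated G K A S := by
  refine ⟨A.toFinite.toFinset, by simp, by rwa [← Set.ncard_eq_toFinset_card], fun s hs ↦ ?_⟩
  simpa using h.exists_adj_left hs

theorem IsFullPair.dominated_of_subsingleton [Finite V] (h : IsFullPair G A B S)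
    (hA : A.Subsingleton) : Dominated G 1 A S :=
  h.dominated_of_ncard_le ((Set.ncard_le_one_iff_subsingleton).2 hA)

theorem exists_adj_of_nontrivial (hA : (G.induce A).Preconnected) (hnt : A.Nontrivial) :
    ∃ x ∈ A, ∃ y ∈ A, G.Adj x y := by
  obtain ⟨x, hx⟩ := hnt.nonempty
  have := hnt.coe_sort
  obtain ⟨⟨y, hy⟩, hxy⟩ := hA.exists_adj_of_nontrivial ⟨x, hx⟩
  exact ⟨x, hx, y, hy, hxy⟩

theorem IsFullPair.dominated_of_P4_free (h : IsFullPair G A B S) (hG : ¬ P4.graph ⊴ G) :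
    Dominated G 1 A S := by
  obtain ⟨a, ha⟩ := h.connected_left.nonempty
  refine ⟨{a}, by simpa using ha, by simp, fun s hs ↦ ⟨a, by simp, ?_⟩⟩
  obtain ⟨x, hx, hxs⟩ := h.exists_adj_left hs
  obtain ⟨b, hb, hbs⟩ := h.symm.exists_adj_left hs
  refine subset_of_adj_closed (X := {v | G.Adj v s}) h.connected_left.preconnected hx hxs
    (fun u hu hus v hv huv ↦ ?_) ha
  rcases adj_of_P4_free hG hbs (G.adj_symm hus) huv with hbu | hbv | hsv
  · exact (h.symm.not_adj hb hu hbu).elim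
  · exact (h.symm.not_adj hb hv hbv).elim
  · exact hsv.symm

theorem IsFullPair.subsingleton_of_twoK2_free (h : IsFullPair G A B S)
    (hG : ¬ twoK2.graph ⊴ G) : A.Subsingleton ∨ B.Subsingleton := by
  simp only [← Set.not_nontrivial_iff, ← not_and_or]
  rintro ⟨hA, hB⟩
  obtain ⟨x, hx, y, hy, hxy⟩ := exists_adj_of_nontrivial h.connected_left.preconnected hA
  obtain ⟨z, hz, w, hw, hzw⟩ := exists_adj_of_nontrivial h.connected_right.preconnected hB
  have := adj_of_twoK2_free hG hxy hzw
  grind [h.not_adj]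

theorem IsFullPair.isClique_of_coDiamond_free (h : IsFullPair G A B S)
    (hG : ¬ coDiamond.graph ⊴ G) (hB : B.Nontrivial) : G.IsClique A := fun x hx y hy hxy ↦ by
  obtain ⟨z, hz, w, hw, hzw⟩ := exists_adj_of_nontrivial h.connected_right.preconnected hB
  have := adj_of_coDiamond_free hG hzw hxy
  grind [h.symm.not_adj]

theorem IsFullPair.isClique_of_coPaw_free (h : IsFullPair G A B S) (hG : ¬ coPaw.graph ⊴ G) :
    G.IsClique A := fun x hx y hy hxy ↦ by
  obtain ⟨b, hb⟩ := h.connected_right.nonempty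
  have hsub : A ⊆ {v | v = x ∨ G.Adj x v} := by
    refine subset_of_adj_closed h.connected_left.preconnected hx (.inl rfl) ?_
    rintro u hu (rfl | hxu) v hv huv
    · exact .inr huv
    · have := adj_of_coPaw_free (w := b) hG hxu huv
      grind [h.not_adj]
  exact (hsub hy).resolve_left hxy.symm

theorem IsFullPair.indepSetFreeOn_of_fourP1_free (h : IsFullPair G A B S)
    (hG : ¬ fourP1.graph ⊴ G) : G.IndepSetFreeOn A 3 := by
  obtain ⟨b, hb⟩ := h.connected_right.nonempty
  refine indepSetFreeOn_three_iff.2 fun x hx y hy z hz hxy hxz hyz ↦ ?_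
  have := adj_of_fourP1_free hG hxy hxz (h.ne hx hb) hyz (h.ne hy hb) (h.ne hz hb)
  grind [h.not_adj]

theorem IsFullPair.cliqueFreeOn_of_coClaw_free (h : IsFullPair G A B S)
    (hG : ¬ coClaw.graph ⊴ G) : G.CliqueFreeOn A 3 := by
  obtain ⟨b, hb⟩ := h.connected_right.nonempty
  refine cliqueFreeOn_three_iff.2 fun x hx y hy z hz hxy hxz hyz ↦ ?_
  have := adj_of_coClaw_free hG hxy hxz hyz b
  grind [h.not_adj]

theorem IsFullPair.not_adj_of_paw_free (h : IsFullPair G A B S) (hG : ¬ paw.graph ⊴ G)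
    (hs : s ∈ S) (hx : x ∈ A) (hy : y ∈ A) (hsx : G.Adj s x) (hsy : G.Adj s y) :
    ¬ G.Adj x y := fun hxy ↦ by
  obtain ⟨b, hb, hbs⟩ := h.symm.exists_adj_left hs
  exact (adj_of_paw_free hG hsx hsy hxy hbs.symm).elim (h.not_adj hx hb) (h.not_adj hy hb)

theorem IsFullPair.cliqueFreeOn_of_paw_free (h : IsFullPair G A B S) (hG : ¬ paw.graph ⊴ G)
    (hS : S.Nonempty) : G.CliqueFreeOn A 3 := by
  refine cliqueFreeOn_three_iff.2 fun x hx y hy z hz hxy hxz hyz ↦ ?_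
  obtain ⟨s, hs⟩ := hS
  obtain ⟨a, ha, has⟩ := h.exists_adj_left hs
  have hsub : A ⊆ {v | ∃ y ∈ A, ∃ z ∈ A, G.Adj v y ∧ G.Adj v z ∧ G.Adj y z} := by
    refine subset_of_adj_closed h.connected_left.preconnected hx ⟨y, hy, z, hz, hxy, hxz, hyz⟩ ?_
    rintro u hu ⟨p, hp, q, hq, hup, huq, hpq⟩ v _ huv
    rcases adj_of_paw_free hG hup huq hpq huv with hpv | hqv
    · exact ⟨u, hu, p, hp, huv.symm, hpv.symm, hup⟩
    · exact ⟨u, hu, q, hq, huv.symm, hqv.symm, huq⟩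
  obtain ⟨p, hp, q, hq, hap, haq, hpq⟩ := hsub ha
  rcases adj_of_paw_free hG hap haq hpq has with hps | hqs
  · exact h.not_adj_of_paw_free hG hs ha hp has.symm hps.symm hap
  · exact h.not_adj_of_paw_free hG hs ha hq has.symm hqs.symm haq

end Sides

section Bounds

variable {V : Type*} {G : SimpleGraph V} {A B S U : Set V} {s : Finset V} {k m n : ℕ}

theorem eq_empty_of_cliqueFreeOn_one (h : G.CliqueFreeOn s 1) : s = ∅ := by
  by_contra! ⟨v, hv⟩
  exact h (t := {v}) (by simpa using hv) (by simp)

theorem card_lt_choose_of_cliqueFreeOn_compl (hm : G.CliqueFreeOn s (m + 1))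
    (hn : Gᶜ.CliqueFreeOn s (n + 1)) : s.card < (m + n).choose m := by
  classical
  induction m generalizing n s with
  | zero => simp [eq_empty_of_cliqueFreeOn_one hm]
  | succ m ihm =>
    induction n generalizing s with
    | zero => simp [eq_empty_of_cliqueFreeOn_one hn]
    | succ n ihn =>
      rcases s.eq_empty_or_nonempty with rfl | ⟨v, hv⟩
      · simp [Nat.choose_pos]
      have hN : (s.filter (G.Adj v)).card < (m + (n + 1)).choose m := by
        refine ihm ?_ (CliqueFreeOn.subset _ (Finset.filter_subset _ _) hn)
        exact CliqueFreeOn.subset _ (by simp [Set.subset_def]) (hm.of_succ _ hv)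
      have hM : (s.filter (Gᶜ.Adj v)).card < (m + 1 + n).choose (m + 1) := by
        refine ihn (CliqueFreeOn.subset _ (Finset.filter_subset _ _) hm) ?_
        exact CliqueFreeOn.subset _ (by simp [Set.subset_def]) (hn.of_succ _ hv)
      have hs : s ⊆ insert v (s.filter (G.Adj v) ∪ s.filter (Gᶜ.Adj v)) := fun w hw ↦ by
        simp only [Finset.mem_insert, Finset.mem_union, Finset.mem_filter, compl_adj]
        grind
      calc s.card ≤ (s.filter (G.Adj v) ∪ s.filter (Gᶜ.Adj v)).card + 1 :=
            (Finset.card_le_card hs).trans (Finset.card_insert_le _ _)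
        _ ≤ (s.filter (G.Adj v)).card + (s.filter (Gᶜ.Adj v)).card + 1 := by
            gcongr; exact Finset.card_union_le _ _
        _ < (m + (n + 1)).choose m + (m + 1 + n).choose (m + 1) := by omega
        _ = (m + 1 + (n + 1)).choose (m + 1) := by
            rw [add_right_comm m 1 n, add_assoc m n 1, add_right_comm m 1, Nat.choose_succ_succ]

theorem IsFullPair.dominated_of_cliqueFreeOn [Finite V] (h : IsFullPair G A B S)
    (hm : G.CliqueFreeOn A (m + 1)) (hn : G.IndepSetFreeOn A (n + 1)) :
    Dominated G ((m + n).choose m) A S := by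
  refine h.dominated_of_ncard_le ?_
  rw [Set.ncard_eq_toFinset_card]
  rw [indepSetFreeOn_iff_compl] at hn
  exact (card_lt_choose_of_cliqueFreeOn_compl (by simpa) (by simpa)).le

theorem exists_adj_of_C4_free [Finite V] (hG : ¬ C4.graph ⊴ G) (hA : G.IsClique A)
    (hAU : Disjoint A U) (hU : U.Nonempty) (hadj : ∀ u ∈ U, ∃ a ∈ A, G.Adj a u) :
    ∃ u ∈ U, ∃ a ∈ A, G.Adj a u ∧ ∀ s ∈ U, G.Adj u s → G.Adj a s := by
  obtain ⟨u, hu, hmin⟩ := U.toFinite.exists_minimalFor (fun u ↦ A ∩ G.neighborSet u) U hU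
  obtain ⟨a, ha, hau⟩ := hadj u hu
  refine ⟨u, hu, a, ha, hau, fun s hs hus ↦ ?_⟩
  by_contra has
  have hsub : A ∩ G.neighborSet s ⊆ A ∩ G.neighborSet u := fun t ⟨ht, hst⟩ ↦ by
    have hta : G.Adj t a := hA ht ha (by rintro rfl; exact has hst.symm)
    have := adj_of_C4_free hG hst hta hau hus (hAU.ne_of_mem ha hs).symm (hAU.ne_of_mem ht hu)
    exact ⟨ht, (this.resolve_left (mt G.adj_symm has)).symm⟩
  exact has (hmin hs hsub ⟨ha, hau.symm⟩).2.symm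

theorem dominated_of_C4_free [Finite V] (hG : ¬ C4.graph ⊴ G) (hA : G.IsClique A)
    (hAU : Disjoint A U) (hadj : ∀ u ∈ U, ∃ a ∈ A, G.Adj a u)
    (hU : G.IndepSetFreeOn U (k + 1)) : Dominated G k A U := by
  classical
  rw [indepSetFreeOn_iff_compl] at hU
  induction k generalizing U with
  | zero =>
    refine ⟨∅, by simp, by simp, fun u hu ↦ ?_⟩
    exact (hU (t := {u}) (by simpa using hu) (by simp)).elim
  | succ k ih =>
    rcases U.eq_empty_or_nonempty with rfl | hne
    · exact ⟨∅, by simp, by simp, by simp⟩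
    obtain ⟨u, hu, a, ha, hau, has⟩ := exists_adj_of_C4_free hG hA hAU hne hadj
    obtain ⟨T, hTA, hTk, hT⟩ := ih (U := U ∩ Gᶜ.neighborSet u)
      (hAU.mono_right Set.inter_subset_left) (fun s hs ↦ hadj s hs.1) (hU.of_succ _ hu)
    refine ⟨insert a T, by simp [Set.insert_subset_iff, ha, hTA],
      (Finset.card_insert_le _ _).trans (by gcongr), fun s hs ↦ ?_⟩
    by_cases hsu : s ∈ Gᶜ.neighborSet u
    · obtain ⟨t, ht, hts⟩ := hT s ⟨hs, hsu⟩
      exact ⟨t, Finset.mem_insert_of_mem ht, hts⟩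
    · refine ⟨a, Finset.mem_insert_self _ _, ?_⟩
      rw [mem_neighborSet, compl_adj, not_and_or, not_not, not_not] at hsu
      rcases hsu with rfl | hus
      exacts [hau, has s hs hus]

end Bounds

section ExcludedPairs

variable {V : Type*} {G : SimpleGraph V} {A B S : Set V} {a b s t u : V}

theorem IsFullPair.isClique_or_isClique_of_fourP1_free (h : IsFullPair G A B S)
    (hG : ¬ fourP1.graph ⊴ G) : G.IsClique A ∨ G.IsClique B := by
  by_contra! hno
  obtain ⟨hA, hB⟩ := hno
  simp only [isClique_iff, Set.Pairwise, not_forall] at hA hB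
  obtain ⟨x, hx, y, hy, hxy, hxy'⟩ := hA
  obtain ⟨z, hz, w, hw, hzw, hzw'⟩ := hB
  have := adj_of_fourP1_free hG hxy (h.ne hx hz) (h.ne hx hw) (h.ne hy hz) (h.ne hy hw) hzw
  grind [h.not_adj]

theorem indepSetFreeOn_four_of_fourP1_free (hG : ¬ fourP1.graph ⊴ G) :
    G.IndepSetFreeOn A 4 := by
  rw [indepSetFreeOn_iff_compl]
  refine CliqueFree.cliqueFreeOn _ (not_isIndContained_K4_iff.1 ?_)
  rwa [← compl_isIndContained_compl, compl_compl, K4, compl_top]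

theorem IsFullPair.disjoint_commonNeighbors_of_C4_free (h : IsFullPair G A B S)
    (hG : ¬ C4.graph ⊴ G) (hst : s ≠ t) (hst' : ¬ G.Adj s t)
    (hA : (A ∩ G.commonNeighbors s t).Nonempty) : Disjoint B (G.commonNeighbors s t) := by
  obtain ⟨a, ha, hsa, hta⟩ := hA
  refine Set.disjoint_left.2 fun b hb ⟨hsb, htb⟩ ↦ ?_
  rcases adj_of_C4_free hG hsa hta.symm htb hsb.symm hst (h.ne ha hb) with hst | hab
  exacts [hst' hst, h.not_adj ha hb hab]

theorem IsFullPair.commonNeighbors_nonempty_of_coDiamond_free (h : IsFullPair G A B S)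
    (hG : ¬ coDiamond.graph ⊴ G) (hs : s ∈ S) (htu : t ≠ u)
    (hst : ¬ G.Adj s t) (hsu : ¬ G.Adj s u) (htu' : ¬ G.Adj t u) :
    (A ∩ G.commonNeighbors s t).Nonempty ∨ (A ∩ G.commonNeighbors s u).Nonempty := by
  obtain ⟨a, ha, has⟩ := h.exists_adj_left hs
  rcases adj_of_coDiamond_free hG has htu with hat | hau | hst' | hsu' | htu''
  · exact .inl ⟨a, ha, has.symm, hat.symm⟩
  · exact .inr ⟨a, ha, has.symm, hau.symm⟩
  exacts [(hst hst').elim, (hsu hsu').elim, (htu' htu'').elim]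

theorem IsFullPair.commonNeighbors_nonempty_of_coPaw_free (h : IsFullPair G A B S)
    (hG : ¬ coPaw.graph ⊴ G) (hs : s ∈ S) (ht : t ∈ S) (hsu : s ≠ u) (htu : t ≠ u)
    (hst : ¬ G.Adj s t) (hsu' : ¬ G.Adj s u) (htu' : ¬ G.Adj t u) :
    (A ∩ G.commonNeighbors s t).Nonempty := by
  obtain ⟨a, ha, has⟩ := h.exists_adj_left hs
  obtain ⟨b, hb, hbt⟩ := h.exists_adj_left ht
  by_contra! hno
  have hno (v) (hv : v ∈ A) : G.Adj v s → ¬ G.Adj v t := fun hvs hvt ↦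
    Set.notMem_empty v (hno ▸ ⟨hv, hvs.symm, hvt.symm⟩)
  have hua : ¬ G.Adj u a := fun hua ↦ by
    have := adj_of_coPaw_free (w := t) hG hua has hsu.symm
    grind [SimpleGraph.Adj.symm]
  have hub : ¬ G.Adj u b := fun hub ↦ by
    have := adj_of_coPaw_free (w := s) hG hub hbt htu.symm
    grind [SimpleGraph.Adj.symm]
  have hab : G.Adj a b := h.isClique_of_coPaw_free hG ha hb (by grind)
  have := adj_of_coPaw_free (w := u) hG has.symm hab (h.disjoint_left.ne_of_mem hb hs).symm
  grind [SimpleGraph.Adj.symm]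

theorem IsFullPair.indepSetFreeOn_of_C4_free_of_coDiamond_free (h : IsFullPair G A B S)
    (hC : ¬ C4.graph ⊴ G) (hG : ¬ coDiamond.graph ⊴ G) : G.IndepSetFreeOn S 3 := by
  refine indepSetFreeOn_three_iff.2 fun s hs t ht u hu hst hsu htu ↦ ?_
  by_contra! ⟨hst', hsu', htu'⟩
  have two_pairs {A B : Set V} (h : IsFullPair G A B S) :
      ((A ∩ G.commonNeighbors s t).Nonempty ∨ (A ∩ G.commonNeighbors s u).Nonempty) ∧
      ((A ∩ G.commonNeighbors s t).Nonempty ∨ (A ∩ G.commonNeighbors t u).Nonempty) ∧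
      ((A ∩ G.commonNeighbors s u).Nonempty ∨ (A ∩ G.commonNeighbors t u).Nonempty) := by
    have hs := h.commonNeighbors_nonempty_of_coDiamond_free hG hs htu hst' hsu' htu'
    have ht := h.commonNeighbors_nonempty_of_coDiamond_free hG ht hsu (mt G.adj_symm hst')
      htu' hsu'
    have hu := h.commonNeighbors_nonempty_of_coDiamond_free hG hu hst (mt G.adj_symm hsu')
      (mt G.adj_symm htu') hst'
    rw [G.commonNeighbors_symm t s] at ht
    rw [G.commonNeighbors_symm u s, G.commonNeighbors_symm u t] at hu
    exact ⟨hs, ht, hu⟩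
  have hA := two_pairs h
  have hB := two_pairs h.symm
  simp only [← Set.not_disjoint_iff_nonempty_inter] at hB
  have := h.disjoint_commonNeighbors_of_C4_free hC hst hst'
  have := h.disjoint_commonNeighbors_of_C4_free hC hsu hsu'
  have := h.disjoint_commonNeighbors_of_C4_free hC htu htu'
  grind

theorem IsFullPair.indepSetFreeOn_of_C4_free_of_coPaw_free (h : IsFullPair G A B S)
    (hC : ¬ C4.graph ⊴ G) (hG : ¬ coPaw.graph ⊴ G) : G.IndepSetFreeOn S 3 := by
  refine indepSetFreeOn_three_iff.2 fun s hs t ht u _ hst hsu htu ↦ ?_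
  by_contra! ⟨hst', hsu', htu'⟩
  have common {A B : Set V} (h : IsFullPair G A B S) :=
    h.commonNeighbors_nonempty_of_coPaw_free hG hs ht hsu htu hst' hsu' htu'
  exact Set.not_disjoint_iff_nonempty_inter.2 (common h.symm)
    (h.disjoint_commonNeighbors_of_C4_free hC hst hst' (common h))

end ExcludedPairs

section ClawFree

variable {V : Type*} {G : SimpleGraph V} {A B S : Set V} {a s x y : V}

theorem ncard_setOf_ncard_neighborSet_le_one [Finite V] (hG : G.Connected)
    (hdeg : ∀ v, (G.neighborSet v).ncard ≤ 2) :
    {v | (G.neighborSet v).ncard ≤ 1}.ncard ≤ 2 := by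
  classical
  have := Fintype.ofFinite V
  simp only [Set.ncard_eq_toFinset_card', ← neighborFinset_def, card_neighborFinset_eq_degree,
    Set.toFinset_ofPred] at hdeg ⊢
  have hedge : Fintype.card V ≤ G.edgeFinset.card + 1 := by
    simpa only [Nat.card_eq_fintype_card, ← edgeFinset_card]
      using hG.card_vert_le_card_edgeSet_add_one
  have hsum : ∑ v, (G.degree v + if G.degree v ≤ 1 then 1 else 0) ≤ ∑ _v : V, 2 :=
    Finset.sum_le_sum fun v _ ↦ by grind
  rw [Finset.sum_add_distrib, G.sum_degrees_eq_twice_card_edges, Finset.sum_const,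
    Finset.card_univ, ← Finset.card_filter, smul_eq_mul] at hsum
  omega

theorem ncard_neighborSet_induce (G : SimpleGraph V) (A : Set V) (a : A) :
    ((G.induce A).neighborSet a).ncard = (A ∩ G.neighborSet a).ncard := by
  rw [← Set.ncard_image_of_injective _ Subtype.val_injective]
  congr 1
  ext v
  simp [comap_adj, and_comm]

theorem ncard_inter_neighborSet_le_two_of_claw_free (hG : ¬ claw.graph ⊴ G)
    (hA : G.CliqueFreeOn A 3) (ha : a ∈ A) : (A ∩ G.neighborSet a).ncard ≤ 2 := by
  rw [cliqueFreeOn_three_iff] at hA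
  by_contra! hlt
  obtain ⟨x, y, z, ⟨hx, hax⟩, ⟨hy, hay⟩, ⟨hz, haz⟩, hxy, hxz, hyz⟩ :=
    (Set.two_lt_ncard_iff (Set.finite_of_ncard_pos (by omega))).1 hlt
  rcases adj_of_claw_free hG hax hay haz hxy hxz hyz with hxy | hxz | hyz
  · exact hA a ha x hx y hy hax hay hxy
  · exact hA a ha x hx z hz hax haz hxz
  · exact hA a ha y hy z hz hay haz hyz

theorem ncard_inter_neighborSet_le_one_of_claw_free (hG : ¬ claw.graph ⊴ G)
    (hA : G.CliqueFreeOn A 3) (ha : a ∈ A) (hs : s ∉ A) (has : G.Adj a s)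
    (htri : ∀ x ∈ A, G.Adj s x → ¬ G.Adj a x) : (A ∩ G.neighborSet a).ncard ≤ 1 := by
  rw [cliqueFreeOn_three_iff] at hA
  by_contra! hlt
  obtain ⟨x, y, ⟨hx, hax⟩, ⟨hy, hay⟩, hxy⟩ :=
    (Set.one_lt_ncard_iff (Set.finite_of_ncard_pos (by omega))).1 hlt
  rcases adj_of_claw_free hG has hax hay (ne_of_mem_of_not_mem hx hs).symm
    (ne_of_mem_of_not_mem hy hs).symm hxy with hsx | hsy | hxy
  · exact htri x hx hsx hax
  · exact htri y hy hsy hay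
  · exact hA a ha x hx y hy hax hay hxy

-- `A` induces a path or a cycle, and only its vertices of degree at most one see the separator.
theorem IsFullPair.dominated_of_claw_free [Finite V] (h : IsFullPair G A B S)
    (hG : ¬ claw.graph ⊴ G) (hA : G.CliqueFreeOn A 3)
    (htri : ∀ s ∈ S, ∀ x ∈ A, ∀ y ∈ A, G.Adj s x → G.Adj s y → ¬ G.Adj x y) :
    Dominated G 2 A S := by
  classical
  set T : Set V := Subtype.val '' {v : A | ((G.induce A).neighborSet v).ncard ≤ 1}
  have hT : T.ncard ≤ 2 := by
    rw [Set.ncard_image_of_injective _ Subtype.val_injective]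
    refine ncard_setOf_ncard_neighborSet_le_one h.connected_left fun v ↦ ?_
    exact (ncard_neighborSet_induce G A v).trans_le
      (ncard_inter_neighborSet_le_two_of_claw_free hG hA v.2)
  refine ⟨T.toFinite.toFinset, by simp [T], by rwa [← Set.ncard_eq_toFinset_card],
    fun s hs ↦ ?_⟩
  obtain ⟨a, ha, has⟩ := h.exists_adj_left hs
  have haT : a ∈ T := by
    refine ⟨⟨a, ha⟩, (ncard_neighborSet_induce G A _).trans_le ?_, rfl⟩
    exact ncard_inter_neighborSet_le_one_of_claw_free hG hA ha
      (h.disjoint_left.notMem_of_mem_right hs) has fun x hx hsx ↦ htri s hs a ha x hx has.symm hsx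
  exact ⟨a, T.toFinite.mem_toFinset.2 haT, has⟩

theorem IsFullPair.dominated_of_claw_free_of_paw_free [Finite V] (h : IsFullPair G A B S)
    (hG : ¬ claw.graph ⊴ G) (hP : ¬ paw.graph ⊴ G) : Dominated G 2 A S := by
  rcases S.eq_empty_or_nonempty with rfl | hS
  · exact ⟨∅, by simp⟩
  · exact h.dominated_of_claw_free hG (h.cliqueFreeOn_of_paw_free hP hS)
      fun s hs x hx y hy ↦ h.not_adj_of_paw_free hP hs hx hy

theorem IsFullPair.isClique_of_claw_free_of_coClaw_free (h : IsFullPair G A B S)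
    (hG : ¬ claw.graph ⊴ G) (hP : ¬ coClaw.graph ⊴ G) (hx : x ∈ A) (hy : y ∈ A)
    (hsx : G.Adj s x) (hsy : G.Adj s y) (hxy : G.Adj x y) : G.IsClique B := by
  have hsB : ∀ b ∈ B, G.Adj s b := fun b hb ↦
    (adj_of_coClaw_free hP hsx hsy hxy b).resolve_right
      (not_or.2 ⟨h.not_adj hx hb, h.not_adj hy hb⟩)
  intro b hb c hc hbc
  exact (adj_of_claw_free hG hsx (hsB b hb) (hsB c hc) (h.ne hx hb) (h.ne hx hc) hbc).resolve_left
    (h.not_adj hx hb) |>.resolve_left (h.not_adj hx hc)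

theorem IsFullPair.dominated_of_claw_free_of_coClaw_free [Finite V] (h : IsFullPair G A B S)
    (hG : ¬ claw.graph ⊴ G) (hP : ¬ coClaw.graph ⊴ G) :
    Dominated G 2 A S ∨ Dominated G 2 B S := by
  by_cases hB : B.ncard ≤ 2
  · exact .inr (h.symm.dominated_of_ncard_le hB)
  refine .inl (h.dominated_of_claw_free hG (h.cliqueFreeOn_of_coClaw_free hP)
    fun s _ x hx y hy hsx hsy hxy ↦ ?_)
  have hcl := h.isClique_of_claw_free_of_coClaw_free hG hP hx hy hsx hsy hxy
  obtain ⟨p, q, r, hp, hq, hr, hpq, hpr, hqr⟩ := (Set.two_lt_ncard_iff).1 (not_le.1 hB)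
  exact cliqueFreeOn_three_iff.1 (h.symm.cliqueFreeOn_of_coClaw_free hP) p hp q hq r hr
    (hcl hp hq hpq) (hcl hp hr hpr) (hcl hq hr hqr)

end ClawFree

section TameClasses

variable {V : Type*} {G : SimpleGraph V} {A B S : Set V} {P Q : FinGraph}

theorem IsFullPair.indepSetFreeOn_or_subsingleton (h : IsFullPair G A B S)
    (hP : P ∈ ({fourP1, coDiamond, coPaw} : Set FinGraph)) (hG : ¬ P.graph ⊴ G) :
    G.IndepSetFreeOn A 3 ∨ B.Subsingleton := by
  have of_isClique (hA : G.IsClique A) : G.IndepSetFreeOn A 3 :=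
    indepSetFreeOn_three_iff.2 fun x hx y hy _ _ hxy _ _ ↦ .inl (hA hx hy hxy)
  rw [← Set.not_nontrivial_iff, ← imp_iff_or_not]
  intro hB
  rcases hP with rfl | rfl | rfl
  · exact h.indepSetFreeOn_of_fourP1_free hG
  · exact of_isClique (h.isClique_of_coDiamond_free hG hB)
  · exact of_isClique (h.isClique_of_coPaw_free hG)

theorem IsFullPair.cliqueFreeOn_or_eq_empty (h : IsFullPair G A B S)
    (hP : P ∈ ({paw, coClaw, K4} : Set FinGraph)) (hG : ¬ P.graph ⊴ G) :
    G.CliqueFreeOn A 4 ∨ S = ∅ := by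
  rw [← Set.not_nonempty_iff_eq_empty, ← imp_iff_or_not]
  intro hS
  rcases hP with rfl | rfl | rfl
  · exact CliqueFreeOn.mono _ (by norm_num) (h.cliqueFreeOn_of_paw_free hG hS)
  · exact CliqueFreeOn.mono _ (by norm_num) (h.cliqueFreeOn_of_coClaw_free hG)
  · exact CliqueFree.cliqueFreeOn _ (not_isIndContained_K4_iff.1 hG)

theorem IsFullPair.isClique_or_isClique (h : IsFullPair G A B S)
    (hP : P ∈ ({fourP1, coDiamond, coPaw} : Set FinGraph)) (hG : ¬ P.graph ⊴ G) :
    G.IsClique A ∨ G.IsClique B := by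
  rcases hP with rfl | rfl | rfl
  · exact h.isClique_or_isClique_of_fourP1_free hG
  · rcases B.subsingleton_or_nontrivial with hB | hB
    exacts [.inr (hB.pairwise _), .inl (h.isClique_of_coDiamond_free hG hB)]
  · exact .inl (h.isClique_of_coPaw_free hG)

theorem IsFullPair.indepSetFreeOn_separator (h : IsFullPair G A B S)
    (hP : P ∈ ({fourP1, coDiamond, coPaw} : Set FinGraph)) (hG : ¬ P.graph ⊴ G)
    (hC : ¬ C4.graph ⊴ G) : G.IndepSetFreeOn S 4 := by
  have of_three (hS : G.IndepSetFreeOn S 3) : G.IndepSetFreeOn S 4 :=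
    indepSetFreeOn_iff_compl.2 (CliqueFreeOn.mono _ (by norm_num) (indepSetFreeOn_iff_compl.1 hS))
  rcases hP with rfl | rfl | rfl
  · exact indepSetFreeOn_four_of_fourP1_free hG
  · exact of_three (h.indepSetFreeOn_of_C4_free_of_coDiamond_free hC hG)
  · exact of_three (h.indepSetFreeOn_of_C4_free_of_coPaw_free hC hG)

theorem IsFullPair.dominated_of_fourP1_coDiamond_coPaw_of_C4 [Finite V] (h : IsFullPair G A B S)
    (hP : P ∈ ({fourP1, coDiamond, coPaw} : Set FinGraph)) (hG : ¬ P.graph ⊴ G)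
    (hC : ¬ C4.graph ⊴ G) : Dominated G 3 A S ∨ Dominated G 3 B S := by
  have hS := h.indepSetFreeOn_separator hP hG hC
  exact (h.isClique_or_isClique hP hG).imp
    (dominated_of_C4_free hC · h.disjoint_left (fun _ ↦ h.exists_adj_left) hS)
    (dominated_of_C4_free hC · h.symm.disjoint_left (fun _ ↦ h.symm.exists_adj_left) hS)

theorem IsFullPair.dominated_of_fourP1_coDiamond_coPaw_of_paw_coClaw_K4 [Finite V]
    (h : IsFullPair G A B S)
    (hP : P ∈ ({fourP1, coDiamond, coPaw} : Set FinGraph)) (hGP : ¬ P.graph ⊴ G)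
    (hQ : Q ∈ ({paw, coClaw, K4} : Set FinGraph)) (hGQ : ¬ Q.graph ⊴ G) :
    Dominated G 10 A S ∨ Dominated G 10 B S := by
  rcases h.cliqueFreeOn_or_eq_empty hQ hGQ with hA | rfl
  · exact (h.indepSetFreeOn_or_subsingleton hP hGP).imp (h.dominated_of_cliqueFreeOn hA)
      fun hB ↦ (h.symm.dominated_of_subsingleton hB).mono (by norm_num)
  · exact .inl ⟨∅, by simp⟩

theorem tame_freeClass_of_mem_P4_twoK2 (hP : P ∈ ({P4, twoK2} : Set FinGraph)) :
    Tame (freeClass {P}) := by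
  refine tame_of_dominated 1 fun G hG A B S h ↦ ?_
  have hG : ¬ P.graph ⊴ G.graph := hG P rfl
  rcases hP with rfl | rfl
  · exact .inl (h.dominated_of_P4_free hG)
  · exact (h.subsingleton_of_twoK2_free hG).imp h.dominated_of_subsingleton
      h.symm.dominated_of_subsingleton

theorem tame_freeClass_pair_of_mem_fourP1_coDiamond_coPaw
    (hP : P ∈ ({fourP1, coDiamond, coPaw} : Set FinGraph))
    (hQ : Q ∈ ({paw, coClaw, K4, C4} : Set FinGraph)) : Tame (freeClass {P, Q}) := by
  refine tame_of_dominated 10 fun G hG A B S h ↦ ?_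
  have hGP : ¬ P.graph ⊴ G.graph := hG P (by simp)
  have hGQ : ¬ Q.graph ⊴ G.graph := hG Q (by simp)
  have hQ : Q ∈ ({paw, coClaw, K4} : Set FinGraph) ∨ Q = C4 := by
    simpa only [Set.mem_insert_iff, Set.mem_singleton_iff, or_assoc] using hQ
  rcases hQ with hQ | rfl
  · exact h.dominated_of_fourP1_coDiamond_coPaw_of_paw_coClaw_K4 hP hGP hQ hGQ
  · exact (h.dominated_of_fourP1_coDiamond_coPaw_of_C4 hP hGP hGQ).imp
      (.mono (by norm_num)) (.mono (by norm_num))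

theorem tame_freeClass_claw_of_mem_paw_coClaw (hP : P ∈ ({paw, coClaw} : Set FinGraph)) :
    Tame (freeClass {claw, P}) := by
  refine tame_of_dominated 2 fun G hG A B S h ↦ ?_
  have hGclaw : ¬ claw.graph ⊴ G.graph := hG claw (by simp)
  have hGP : ¬ P.graph ⊴ G.graph := hG P (by simp)
  rcases hP with rfl | rfl
  · exact .inl (h.dominated_of_claw_free_of_paw_free hGclaw hGP)
  · exact h.dominated_of_claw_free_of_coClaw_free hGclaw hGP

theorem tame_freeClass {F : Set FinGraph} (hF : ∀ H ∈ F, H.order ≤ 4)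
    (h₁ : ¬ FamilyLE {threeP1, diamond} F) (h₂ : ¬ FamilyLE {claw, K4, C4, diamond} F)
    (h₃ : ¬ FamilyLE {K3, C4} F) : Tame (freeClass F) := by
  have of_one : (∃ P ∈ ({P4, twoK2} : Set FinGraph), P ∉ freeClass F) → Tame (freeClass F) :=
    fun ⟨P, hP, hPF⟩ ↦ (tame_freeClass_of_mem_P4_twoK2 hP).mono
      (freeClass_subset_freeClass (by simpa using hPF))
  rcases exists_notMem_of_not_familyLE_claw_K4_C4_diamond hF h₂ with
    h | ⟨P, hP, hPF⟩ | ⟨Q, hQ, hQF⟩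
  · exact of_one h
  · rcases exists_notMem_of_not_familyLE_threeP1_diamond hF h₁ with h | ⟨Q, hQ, hQF⟩
    · exact of_one h
    · exact (tame_freeClass_pair_of_mem_fourP1_coDiamond_coPaw hP hQ).mono
        (freeClass_subset_freeClass (by simp [hPF, hQF]))
  · rcases exists_notMem_of_not_familyLE_K3_C4 hF h₃ with h | ⟨P, hP, hPF⟩ | hclaw
    · exact of_one h
    · refine (tame_freeClass_pair_of_mem_fourP1_coDiamond_coPaw (Q := Q) hP ?_).mono
        (freeClass_subset_freeClass (by simp [hPF, hQF]))
      exact hQ.imp_right .inl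
    · exact (tame_freeClass_claw_of_mem_paw_coClaw hQ).mono
        (freeClass_subset_freeClass (by simp [hclaw, hQF]))

end TameClasses

section LowerBound

theorem not_tame_of_two_pow_le {C : Set FinGraph} (c d : ℕ)
    (h : ∀ n : ℕ, ∃ G ∈ C, G.order = c * n + d ∧ 2 ^ n ≤ G.numMinSeparators) : ¬ Tame C := by
  rintro ⟨p, hp⟩
  have hlog : 0 < Real.log 2 := Real.log_pos one_lt_two
  let q : Polynomial ℝ := p.comp
    (Polynomial.C (c / Real.log 2) * Polynomial.X + Polynomial.C (d : ℝ))
  have hq (n : ℕ) : q.eval (n * Real.log 2) = p.eval ((c * n + d : ℕ) : ℝ) := by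
    simp only [q, Polynomial.eval_comp, Polynomial.eval_add, Polynomial.eval_mul,
      Polynomial.eval_C, Polynomial.eval_X]
    congr 1
    push_cast
    field_simp
  have hexp (n : ℕ) : Real.exp (n * Real.log 2) = 2 ^ n := by
    rw [Real.exp_nat_mul, Real.exp_log two_pos]
  have hlim := (Polynomial.tendsto_div_exp_atTop q).comp
    (tendsto_natCast_atTop_atTop.atTop_mul_const hlog)
  obtain ⟨n, hn⟩ := (hlim.eventually_lt_const one_pos).exists
  obtain ⟨G, hG, hord, hnum⟩ := h n
  refine hn.not_ge ?_
  rw [Function.comp_apply, hq, hexp, one_le_div (by positivity), ← hord]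
  calc (2 : ℝ) ^ n ≤ G.numMinSeparators := mod_cast hnum
    _ ≤ p.eval (G.order : ℝ) := hp G hG

end LowerBound

section Ladder

variable {W : Type*} {R : SimpleGraph W} {I J T : Set W} {b c : Bool} {v w : W}

/-- The ladder over `R` with rungs `I`: two copies of `R`, in which the two copies of a vertex are
joined by an edge if that vertex lies in `I`. -/
def ladder (R : SimpleGraph W) (I : Set W) : SimpleGraph (Bool × W) where
  Adj p q := p.1 = q.1 ∧ R.Adj p.2 q.2 ∨ p.1 ≠ q.1 ∧ p.2 = q.2 ∧ p.2 ∈ I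
  symm := ⟨fun _ _ ↦ Or.imp (fun ⟨h, h'⟩ ↦ ⟨h.symm, h'.symm⟩)
    fun ⟨h, h', hI⟩ ↦ ⟨h.symm, h'.symm, h' ▸ hI⟩⟩
  loopless := ⟨fun _ ↦ by simp⟩

theorem ladder_adj :
    (ladder R I).Adj (b, v) (c, w) ↔ b = c ∧ R.Adj v w ∨ b ≠ c ∧ v = w ∧ v ∈ I := Iff.rfl

theorem connected_induce_of_compl_subset (hR : (R.induce Iᶜ).Connected)
    (hI : ∀ w ∈ I, ∃ v ∉ I, R.Adj w v) (hJ : Iᶜ ⊆ J) : (R.induce J).Connected := by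
  obtain ⟨c, hc⟩ := hR.nonempty
  refine induce_connected_of_patches c (hJ hc) fun {w} hw ↦ ?_
  by_cases hwI : w ∈ I
  · obtain ⟨v, hv, hwv⟩ := hI w hwI
    have hIw : (R.induce (Iᶜ ∪ {w})).Connected :=
      connected_induce_union hR.preconnected .of_subsingleton hv rfl hwv.symm
    exact ⟨Iᶜ ∪ {w}, Set.union_subset hJ (Set.singleton_subset_iff.2 hw), .inl hc, .inr rfl,
      hIw.preconnected _ _⟩
  · exact ⟨Iᶜ, hJ, hc, hwI, hR.preconnected _ _⟩

theorem connected_induce_ladder_image (b : Bool) (hJ : (R.induce J).Connected) :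
    ((ladder R I).induce (Prod.mk b '' J)).Connected := by
  let f : R.induce J →g (ladder R I).induce (Prod.mk b '' J) :=
    ⟨fun v ↦ ⟨(b, v), v, v.2, rfl⟩, fun h ↦ .inl ⟨rfl, h⟩⟩
  refine hJ.map f ?_
  rintro ⟨_, v, hv, rfl⟩
  exact ⟨⟨v, hv⟩, rfl⟩

theorem boundary_ladder_image (hI : ∀ w ∈ I, ∃ v ∉ I, R.Adj w v) (hJ : Iᶜ ⊆ J) (b : Bool) :
    boundary (ladder R I) (Prod.mk b '' J) = Prod.mk b '' Jᶜ ∪ Prod.mk (!b) '' (I ∩ J) := by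
  ext ⟨c, w⟩
  constructor
  · rintro ⟨hw, _, ⟨v, hv, rfl⟩, ⟨rfl, -⟩ | ⟨hbc, rfl, hI⟩⟩
    · exact .inl ⟨w, fun h ↦ hw ⟨w, h, rfl⟩, rfl⟩
    · obtain rfl : c = !b := Bool.eq_not.2 (Ne.symm hbc)
      exact .inr ⟨v, ⟨hI, hv⟩, rfl⟩
  · rintro (⟨w, hw, ⟨⟩⟩ | ⟨w, ⟨hwI, hwJ⟩, ⟨⟩⟩)
    · obtain ⟨v, hv, hwv⟩ := hI w (not_not.1 fun h ↦ hw (hJ h))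
      exact ⟨by simpa using hw, (b, v), ⟨v, hJ hv, rfl⟩, .inl ⟨rfl, hwv.symm⟩⟩
    · exact ⟨by simp, (b, w), ⟨w, hwJ, rfl⟩, .inr ⟨by simp, rfl, hwI⟩⟩

theorem isFullPair_ladder (hR : (R.induce Iᶜ).Connected) (hI : ∀ w ∈ I, ∃ v ∉ I, R.Adj w v)
    (hT : T ⊆ I) :
    IsFullPair (ladder R I) (Prod.mk true '' Tᶜ) (Prod.mk false '' (I \ T)ᶜ)
      (Prod.mk true '' T ∪ Prod.mk false '' (I \ T)) where
  connected_left := connected_induce_ladder_image true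
    (connected_induce_of_compl_subset hR hI (Set.compl_subset_compl.2 hT))
  connected_right := connected_induce_ladder_image false
    (connected_induce_of_compl_subset hR hI (Set.compl_subset_compl.2 Set.sdiff_subset))
  disjoint := by
    rw [Set.disjoint_left]
    rintro _ ⟨v, -, rfl⟩ ⟨w, -, h⟩
    cases h
  boundary_left := by
    rw [boundary_ladder_image hI (Set.compl_subset_compl.2 hT), compl_compl, Set.sdiff_eq,
      Bool.not_true]
  boundary_right := by
    rw [boundary_ladder_image hI (Set.compl_subset_compl.2 Set.sdiff_subset), compl_compl,
      ← Set.sdiff_eq, Set.sdiff_sdiff_cancel_left hT, Set.union_comm, Bool.not_false]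

end Ladder

section LadderGraph

/-- The ladder over `R` with rungs `I`, as a finite graph. -/
def ladderGraph {W : Type} [Finite W] [Nonempty W] (R : SimpleGraph W) (I : Set W) : FinGraph :=
  ⟨Bool × W, ladder R I⟩

variable {W : Type} [Finite W] [Nonempty W] {R : SimpleGraph W} {I : Set W}

theorem order_ladderGraph : (ladderGraph R I).order = 2 * Nat.card W :=
  (Nat.card_prod Bool W).trans (by rw [Nat.card_eq_fintype_card, Fintype.card_bool])

theorem two_pow_ncard_le_numMinSeparators_ladderGraph (hR : (R.induce Iᶜ).Connected)
    (hI : ∀ w ∈ I, ∃ v ∉ I, R.Adj w v) : 2 ^ I.ncard ≤ (ladderGraph R I).numMinSeparators := by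
  let sep (T : Set W) : Set (Bool × W) := Prod.mk true '' T ∪ Prod.mk false '' (I \ T)
  have hsep : sep.Injective := by
    refine Function.LeftInverse.injective (g := (Prod.mk true ⁻¹' ·)) fun T ↦ ?_
    ext w
    simp [sep]
  rw [← Set.ncard_powerset, ← Set.ncard_image_of_injective _ hsep]
  refine Set.ncard_le_ncard ?_ (Set.toFinite (α := Set (Bool × W)) _)
  rintro _ ⟨T, hT, rfl⟩
  exact mem_minSeparators_iff.2 ⟨_, _, isFullPair_ladder hR hI hT⟩

end LadderGraph

section LadderPatterns

variable {W : Type*} {R : SimpleGraph W} {I : Set W} {p q r : Bool × W}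

theorem ladder_adj_self {b : Bool} {v w : W} :
    (ladder R I).Adj (b, v) (b, w) ↔ R.Adj v w := by
  simp [ladder_adj]

theorem fst_eq_of_ladder_triangle (hpq : (ladder R I).Adj p q) (hpr : (ladder R I).Adj p r)
    (hqr : (ladder R I).Adj q r) : p.1 = q.1 := by
  obtain ⟨b, x⟩ := p
  obtain ⟨c, y⟩ := q
  obtain ⟨d, z⟩ := r
  cases b <;> cases c <;> cases d <;> grind [ladder_adj, R.irrefl]

theorem K3_isIndContained_of_ladder (h : K3.graph ⊴ ladder R I) : K3.graph ⊴ R := by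
  rw [K3_isIndContained_iff] at h ⊢
  obtain ⟨⟨b, x⟩, ⟨c, y⟩, ⟨d, z⟩, hxy, hxz, hyz⟩ := h
  obtain rfl : b = c := fst_eq_of_ladder_triangle hxy hxz hyz
  obtain rfl : b = d := fst_eq_of_ladder_triangle hxz hxy hyz.symm
  exact ⟨x, y, z, ladder_adj_self.1 hxy, ladder_adj_self.1 hxz, ladder_adj_self.1 hyz⟩

theorem quad_isIndContained_of_ladder {a b c d e f : Bool}
    (hfst : ∀ x y z w, (x ≠ y ∧ x ≠ z ∧ x ≠ w ∧ y ≠ z ∧ y ≠ w ∧ z ≠ w) →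
      ((ladder R I).Adj x y ↔ a) → ((ladder R I).Adj x z ↔ b) → ((ladder R I).Adj x w ↔ c) →
      ((ladder R I).Adj y z ↔ d) → ((ladder R I).Adj y w ↔ e) → ((ladder R I).Adj z w ↔ f) →
      x.1 = y.1 ∧ x.1 = z.1 ∧ x.1 = w.1)
    (h : (quad a b c d e f).graph ⊴ ladder R I) : (quad a b c d e f).graph ⊴ R := by
  rw [quad_isIndContained_iff] at h ⊢
  obtain ⟨⟨i, x⟩, ⟨j, y⟩, ⟨k, z⟩, ⟨l, w⟩, hne, hxy, hxz, hxw, hyz, hyw, hzw⟩ := h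
  obtain ⟨rfl, rfl, rfl⟩ : i = j ∧ i = k ∧ i = l := hfst _ _ _ _ hne hxy hxz hxw hyz hyw hzw
  refine ⟨x, y, z, w, by simpa using hne, ?_⟩
  rw [ladder_adj_self] at hxy hxz hxw hyz hyw hzw
  exact ⟨hxy, hxz, hxw, hyz, hyw, hzw⟩

theorem K4_isIndContained_of_ladder (h : K4.graph ⊴ ladder R I) : K4.graph ⊴ R := by
  rw [K4_iso_quad.isIndContained_iff] at h ⊢
  refine quad_isIndContained_of_ladder (fun x y z w _ hxy hxz hxw hyz hyw hzw ↦ ?_) h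
  rw [iff_true_right rfl] at hxy hxz hxw hyz hyw hzw
  exact ⟨fst_eq_of_ladder_triangle hxy hxz hyz, fst_eq_of_ladder_triangle hxz hxw hzw,
    fst_eq_of_ladder_triangle hxw hxz hzw.symm⟩

theorem diamond_isIndContained_of_ladder (h : diamond.graph ⊴ ladder R I) :
    diamond.graph ⊴ R := by
  rw [diamond_iso_quad.isIndContained_iff] at h ⊢
  refine quad_isIndContained_of_ladder (fun x y z w _ _ hxz hxw hyz hyw hzw ↦ ?_) h
  rw [iff_true_right rfl] at hxz hxw hyz hyw hzw
  have hxz' := fst_eq_of_ladder_triangle hxz hxw hzw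
  exact ⟨hxz'.trans (fst_eq_of_ladder_triangle hyz hyw hzw).symm, hxz',
    fst_eq_of_ladder_triangle hxw hxz hzw.symm⟩

theorem C4_isIndContained_of_ladder (hI : ∀ v ∈ I, ∀ w ∈ I, ¬ R.Adj v w)
    (h : C4.graph ⊴ ladder R I) : C4.graph ⊴ R := by
  rw [C4_iso_quad.isIndContained_iff] at h ⊢
  refine quad_isIndContained_of_ladder ?_ h
  rintro ⟨i, x⟩ ⟨j, y⟩ ⟨k, z⟩ ⟨l, w⟩ hne hxy - hxw hyz - hzw
  simp only [iff_true, ladder_adj, ne_eq, Prod.mk.injEq] at *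
  cases i <;> cases j <;> cases k <;> cases l <;> grind

theorem claw_isIndContained_of_ladder
    (hI : ∀ v ∈ I, ∀ x y, R.Adj v x → R.Adj v y → x ≠ y → R.Adj x y)
    (h : claw.graph ⊴ ladder R I) : claw.graph ⊴ R := by
  rw [claw_iso_quad.isIndContained_iff] at h ⊢
  refine quad_isIndContained_of_ladder ?_ h
  rintro ⟨i, x⟩ ⟨j, y⟩ ⟨k, z⟩ ⟨l, w⟩ hne hxy hxz hxw hyz hyw hzw
  simp only [iff_true, ladder_adj, ne_eq, Prod.mk.injEq] at *
  cases i <;> cases j <;> cases k <;> cases l <;> grind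

end LadderPatterns

theorem not_tame_of_isUniversal {F : Set FinGraph} {R : ∀ n, SimpleGraph (Option (Fin n))}
    (hR : ∀ n, (R n).IsUniversal none) (hF : ∀ n, ladderGraph (R n) {none}ᶜ ∈ freeClass F) :
    ¬ Tame (freeClass F) := by
  refine not_tame_of_two_pow_le 2 2 fun n ↦ ⟨ladderGraph (R n) {none}ᶜ, hF n, ?_, ?_⟩
  · rw [order_ladderGraph, Finite.card_option, Nat.card_fin, mul_add_one]
  · have hcard : ({none}ᶜ : Set (Option (Fin n))).ncard = n := by
      rw [Set.ncard_compl, Set.ncard_singleton, Finite.card_option, Nat.card_fin,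
        Nat.add_sub_cancel]
    conv_lhs => rw [← hcard]
    refine two_pow_ncard_le_numMinSeparators_ladderGraph ?_ fun w hw ↦
      ⟨none, not_not.2 rfl, (hR n (Ne.symm hw)).symm⟩
    rw [compl_compl]
    exact { preconnected := .of_subsingleton, nonempty := ⟨⟨none, rfl⟩⟩ }

section CliqueLadder

variable {W : Type*}

theorem not_threeP1_isIndContained_ladder_top {I : Set W} : ¬ threeP1.graph ⊴ ladder ⊤ I := by
  rw [threeP1_isIndContained_iff]
  rintro ⟨⟨b, x⟩, ⟨c, y⟩, ⟨d, z⟩, hne, h⟩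
  cases b <;> cases c <;> cases d <;> grind [ladder_adj, top_adj]

theorem not_diamond_isIndContained_top : ¬ diamond.graph ⊴ (⊤ : SimpleGraph W) := by
  rw [diamond_iso_quad.isIndContained_iff, quad_isIndContained_iff]
  rintro ⟨x, y, -, -, ⟨hxy, -⟩, hadj, -⟩
  exact Bool.false_ne_true (hadj.1 hxy)

theorem not_tame_threeP1_diamond : ¬ Tame (freeClass {threeP1, diamond}) :=
  not_tame_of_isUniversal (fun _ ↦ .top) fun _ H hH ↦ by
    rcases hH with rfl | rfl
    · exact not_threeP1_isIndContained_ladder_top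
    · exact fun h ↦ not_diamond_isIndContained_top (diamond_isIndContained_of_ladder h)

end CliqueLadder

section StarLadder

variable {W : Type*} {v : W}

theorem not_K3_isIndContained_starGraph : ¬ K3.graph ⊴ starGraph v := by
  rw [K3_isIndContained_iff]
  grind [starGraph_adj]

theorem not_C4_isIndContained_starGraph : ¬ C4.graph ⊴ starGraph v := by
  rw [C4_iso_quad.isIndContained_iff, quad_isIndContained_iff]
  grind [starGraph_adj]

theorem not_tame_K3_C4 : ¬ Tame (freeClass {K3, C4}) :=
  not_tame_of_isUniversal (fun _ ↦ isUniversal_starGraph_self) fun _ H hH ↦ by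
    rcases hH with rfl | rfl
    · exact fun h ↦ not_K3_isIndContained_starGraph (K3_isIndContained_of_ladder h)
    · refine fun h ↦ not_C4_isIndContained_starGraph (C4_isIndContained_of_ladder ?_ h)
      grind [starGraph_adj]

end StarLadder

section TrianglePath

variable {n : ℕ} {i j : Fin (2 * n + 1)}

/-- A path on the even numbers in which each edge is completed to a triangle by the odd number
in between. -/
def trianglePath (n : ℕ) : SimpleGraph (Fin (2 * n + 1)) where
  Adj i j := i.1 + 1 = j.1 ∨ j.1 + 1 = i.1 ∨ (i.1 % 2 = 0 ∧ (i.1 + 2 = j.1 ∨ j.1 + 2 = i.1))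
  symm := ⟨fun _ _ _ ↦ by omega⟩
  loopless := ⟨fun _ _ ↦ by omega⟩

theorem trianglePath_adj : (trianglePath n).Adj i j ↔
    i.1 + 1 = j.1 ∨ j.1 + 1 = i.1 ∨ (i.1 % 2 = 0 ∧ (i.1 + 2 = j.1 ∨ j.1 + 2 = i.1)) := Iff.rfl

theorem not_claw_isIndContained_trianglePath : ¬ claw.graph ⊴ trianglePath n := by
  rw [claw_iso_quad.isIndContained_iff, quad_isIndContained_iff]
  grind [trianglePath_adj]

theorem not_K4_isIndContained_trianglePath : ¬ K4.graph ⊴ trianglePath n := by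
  rw [K4_iso_quad.isIndContained_iff, quad_isIndContained_iff]
  grind [trianglePath_adj]

theorem not_C4_isIndContained_trianglePath : ¬ C4.graph ⊴ trianglePath n := by
  rw [C4_iso_quad.isIndContained_iff, quad_isIndContained_iff]
  grind [trianglePath_adj]

theorem not_diamond_isIndContained_trianglePath : ¬ diamond.graph ⊴ trianglePath n := by
  rw [diamond_iso_quad.isIndContained_iff, quad_isIndContained_iff]
  rintro ⟨x, y, z, w, hne, h⟩
  simp only [trianglePath_adj, iff_true, ne_eq, Fin.ext_iff] at hne h
  omega

/-- The odd vertices of `trianglePath n`: the apexes of the triangles erected on the path. -/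
def trianglePathApexes (n : ℕ) : Set (Fin (2 * n + 1)) := {i | i.1 % 2 = 1}

theorem ncard_trianglePathApexes : (trianglePathApexes n).ncard = n := by
  let f (k : Fin n) : Fin (2 * n + 1) := ⟨2 * k + 1, by omega⟩
  have hf : f.Injective := fun k l h ↦ by simpa [f, Fin.ext_iff] using h
  have hrange : trianglePathApexes n = Set.range f := by
    ext i
    constructor
    · intro hi
      have hi : i.1 % 2 = 1 := hi
      exact ⟨⟨i.1 / 2, by omega⟩, Fin.ext (by change 2 * (i.1 / 2) + 1 = i.1; omega)⟩
    · rintro ⟨k, rfl⟩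
      exact Nat.mul_add_mod ..
  rw [hrange, Set.ncard_range_of_injective hf, Nat.card_fin]

theorem connected_induce_compl_trianglePathApexes :
    ((trianglePath n).induce (trianglePathApexes n)ᶜ).Connected := by
  let f (k : Fin (n + 1)) : Fin (2 * n + 1) := ⟨2 * k, by omega⟩
  have hf (k : Fin (n + 1)) : f k ∈ (trianglePathApexes n)ᶜ := by simp [f, trianglePathApexes]
  have hadj {k l : Fin (n + 1)} (h : (pathGraph (n + 1)).Adj k l) :
      (trianglePath n).Adj (f k) (f l) := by
    grind [trianglePath_adj, pathGraph_adj]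
  let φ : pathGraph (n + 1) →g (trianglePath n).induce (trianglePathApexes n)ᶜ :=
    ⟨fun k ↦ ⟨f k, hf k⟩, hadj⟩
  refine (pathGraph_connected n).map φ fun ⟨i, hi⟩ ↦ ?_
  have hi : ¬ i.1 % 2 = 1 := hi
  exact ⟨⟨i.1 / 2, by omega⟩, Subtype.ext (Fin.ext (by change 2 * (i.1 / 2) = i.1; omega))⟩

theorem not_tame_claw_K4_C4_diamond : ¬ Tame (freeClass {claw, K4, C4, diamond}) := by
  refine not_tame_of_two_pow_le 4 2 fun n ↦
    ⟨ladderGraph (trianglePath n) (trianglePathApexes n), ?_, ?_, ?_⟩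
  · rintro H (rfl | rfl | rfl | rfl) h
    · refine not_claw_isIndContained_trianglePath (claw_isIndContained_of_ladder ?_ h)
      grind [trianglePathApexes, trianglePath_adj]
    · exact not_K4_isIndContained_trianglePath (K4_isIndContained_of_ladder h)
    · refine not_C4_isIndContained_trianglePath (C4_isIndContained_of_ladder ?_ h)
      grind [trianglePathApexes, trianglePath_adj]
    · exact not_diamond_isIndContained_trianglePath (diamond_isIndContained_of_ladder h)
  · rw [order_ladderGraph, Nat.card_fin]
    ring
  · conv_lhs => rw [← ncard_trianglePathApexes (n := n)]
    refine two_pow_ncard_le_numMinSeparators_ladderGraph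
      connected_induce_compl_trianglePathApexes fun i hi ↦ ?_
    have hi : i.1 % 2 = 1 := hi
    exact ⟨⟨i.1 - 1, by omega⟩, by grind [trianglePathApexes], by grind [trianglePath_adj]⟩

end TrianglePath

end FinGraph

theorem theorem2_general (F : Set FinGraph) (hF : ∀ H ∈ F, H.order ≤ 4) :
    ¬ FinGraph.Tame (FinGraph.freeClass F) ↔
      (FinGraph.FamilyLE {FinGraph.threeP1, FinGraph.diamond} F ∨
        FinGraph.FamilyLE
          {FinGraph.claw, FinGraph.K4, FinGraph.C4, FinGraph.diamond} F ∨
        FinGraph.FamilyLE {FinGraph.K3, FinGraph.C4} F) := by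
  constructor
  · intro h
    by_contra! ⟨hi, hii, hiii⟩
    exact h (FinGraph.tame_freeClass hF hi hii hiii)
  · rintro (h | h | h) ht
    · exact FinGraph.not_tame_threeP1_diamond (ht.mono h)
    · exact FinGraph.not_tame_claw_K4_C4_diamond (ht.mono h)
    · exact FinGraph.not_tame_K3_C4 (ht.mono h)

theorem theorem2 (F : Set FinGraph) (hF : ∀ H ∈ F, H.order ≤ 4)
    (h₁ : ¬ FinGraph.FamilyEq F {FinGraph.fourP1, FinGraph.C4})
    (h₂ : ¬ FinGraph.FamilyEq F {FinGraph.fourP1, FinGraph.C4, FinGraph.claw}) :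
    ¬ FinGraph.Tame (FinGraph.freeClass F) ↔
      (FinGraph.FamilyLE {FinGraph.threeP1, FinGraph.diamond} F ∨
        FinGraph.FamilyLE
          {FinGraph.claw, FinGraph.K4, FinGraph.C4, FinGraph.diamond} F ∨
        FinGraph.FamilyLE {FinGraph.K3, FinGraph.C4} F) :=
  theorem2_general F hF
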